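/- Let $(G_n)_{n\ge 1}$ be a sequence of non-trivial finite groups, and let $\mathcal G_n=G_n\wr S_n$ be the complete monomial group: its elements are the tuples $(g_1,\dots,g_n;\pi)$ with $g_i\in G_n$, $\pi\in S_n$, and $(g_1,\dots,g_n;\pi)(h_1,\dots,h_n;\eta)=(g_1h_{\pi^{-1}(1)},\dots,g_nh_{\pi^{-1}(n)};\pi\eta)$. Let $P$ be the probability measure on $\mathcal G_n$ (warp-transpose top with random shuffle) that gives mass $\frac{1}{n|G_n|}$ to each element $(1,\dots,1,g;\mathrm{id})$, $g\in G_n$, and to each element $(1,\dots,1,g^{-1},1,\dots,1,g;(i,n))$ with $g^{-1}$ in position $i$ and $g$ in position $n$, $g\in G_n$, $1\le i<n$, and mass $0$ to every other element. Let $\mathscr P$ be the probability measure on $S_n$ (transpose top with random shuffle) that gives mass $\frac1n$ to the identity and to each transposition $(i,n)$, $1\le i<n$. For a measure $p$ on a finite group let $p^{*k}$ be its $k$-fold convolution power, where $(p*q)(x)=\sum_y p(xy^{-1})q(y)$; let $U_\Gamma$ be the uniform distribution on a finite group $\Gamma$, and let $\|\mu-\nu\|_{\mathrm{TV}}=\sup_A|\mu(A)-\nu(A)|$.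 There is a universal constant $a$ (independent of $n$, $C$, $k$ and the groups $G_n$) such that \[\bigl\|\mathscr P^{*\lceil n\log n+Cn\rceil}-U_{S_n}\bigr\|_{\mathrm{TV}}\le a e^{-C}\qquad\text{for all } n\ge 1 \text{ and } C>1,\] and such that the following hold for every such sequence $(G_n)$. 1. For all $n\ge 1$, all $C>1$ and all integers $k\ge n\log n+Cn$, \[\bigl\|P^{*k}-U_{\mathcal G_n}\bigr\|_{\mathrm{TV}}<a e^{-C}+(e+1)e^{-C/2}.\] 2. For every $\epsilon\in(0,1)$, \[\lim_{n\to\infty}\bigl\|P^{*\lfloor(1+\epsilon)n\log n\rfloor}-U_{\mathcal G_n}\bigr\|_{\mathrm{TV}}=0.\] -/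

import Mathlib

noncomputable section

namespace WarpShuffle

/-- The action of `S_n` on `G^n` by permuting coordinates: `(π • h) i = h (π⁻¹ i)`. -/
def permAut (n : ℕ) (G : Type*) [Group G] :
    Equiv.Perm (Fin n) →* MulAut (Fin n → G) where
  toFun π :=
    { toFun := fun h i => h (π⁻¹ i)
      invFun := fun h i => h (π i)
      left_inv := fun h => by ext i; simp
      right_inv := fun h => by ext i; simp
      map_mul' := fun _ _ => rfl }
  map_one' := by ext h i; simp
  map_mul' π η := by ext h i; simp [mul_inv_rev]

/-- The complete monomial group `G ≀ S_n`. Elements are pairs `(g_1, …, g_n; π)`, with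
`(g; π) (h; η) = (i ↦ g_i h_{π⁻¹(i)}; π η)`. -/
abbrev MonomialGroup (n : ℕ) (G : Type*) [Group G] : Type _ :=
  (Fin n → G) ⋊[permAut n G] Equiv.Perm (Fin n)

instance (n : ℕ) (G : Type*) [Group G] [Fintype G] : Fintype (MonomialGroup n G) := by
  classical exact Fintype.ofEquiv _ SemidirectProduct.equivProd.symm

/-- The last of the `n` positions (the "`n`-th position"). -/
def top (n : ℕ+) : Fin n := ⟨n - 1, Nat.sub_lt n.pos one_pos⟩

/-- The element `(1, …, 1, g; 1)` of `G ≀ S_n`. -/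
def lastElt (n : ℕ+) {G : Type*} [Group G] (g : G) : MonomialGroup n G :=
  ⟨Pi.mulSingle (top n) g, 1⟩

/-- The element `(1, …, 1, g⁻¹, 1, …, 1, g; (i, n))` of `G ≀ S_n`, with `g⁻¹` in position `i`
and `g` in position `n`; only used for `i ≠ n`. -/
def warpElt (n : ℕ+) {G : Type*} [Group G] (i : Fin n) (g : G) : MonomialGroup n G :=
  ⟨Pi.mulSingle i g⁻¹ * Pi.mulSingle (top n) g, Equiv.swap i (top n)⟩

open Classical in
/-- The measure `P` on `G ≀ S_n` driving the warp-transpose top with random shuffle. -/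
def warpMeasure (n : ℕ+) (G : Type*) [Group G] [Fintype G] (x : MonomialGroup n G) : ℝ :=
  if (∃ g : G, x = lastElt n g) ∨ (∃ g : G, ∃ i : Fin n, i ≠ top n ∧ x = warpElt n i g) then
    1 / ((n : ℝ) * (Fintype.card G : ℝ))
  else 0

open Classical in
/-- The measure on `S_n` driving the transpose top with random shuffle. -/
def transposeTopMeasure (n : ℕ+) (π : Equiv.Perm (Fin n)) : ℝ :=
  if π = 1 ∨ ∃ i : Fin n, i ≠ top n ∧ π = Equiv.swap i (top n) then 1 / (n : ℝ) else 0

/-- Convolution of measures on a finite group, given by their point masses. -/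
def conv {Γ : Type*} [Group Γ] [Fintype Γ] (p q : Γ → ℝ) (x : Γ) : ℝ :=
  ∑ y : Γ, p (x * y⁻¹) * q y

open Classical in
/-- The `k`-fold convolution `p^{*k}`; `p^{*0}` is the unit mass at the identity. -/
def convPow {Γ : Type*} [Group Γ] [Fintype Γ] (p : Γ → ℝ) : ℕ → Γ → ℝ
  | 0 => fun x => if x = 1 then 1 else 0
  | k + 1 => conv (convPow p k) p

/-- The uniform distribution on a finite set. -/
def uniform (Ω : Type*) [Fintype Ω] (_ : Ω) : ℝ := 1 / (Fintype.card Ω : ℝ)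

/-- Total variation distance `sup_A |μ(A) - ν(A)|` of measures on a finite set. -/
def tvDist {Ω : Type*} [Fintype Ω] (μ ν : Ω → ℝ) : ℝ :=
  ⨆ A : Finset Ω, |∑ x ∈ A, μ x - ∑ x ∈ A, ν x|

end WarpShuffle

end

/-! ### Traces of matrices with a triangular lift -/

noncomputable section

namespace WarpShuffle

open Matrix Filter Topology

/-! The proof bounds the `ℓ¹` distance of the shuffle on `S_n` by a trace, without representation
theory, and then lifts the bound to `G ≀ S_n` by a coupon-collector argument.

On `S_n`, Cauchy–Schwarz bounds the squared `ℓ¹` distance to uniformity after `k` steps by `n! W /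
n^(2k) - 1`, where `W` counts the words of length `2k` in the `n` letters `swap l o` (`l = o` giving
the identity) with product `1` (`sq_sum_abs_sub_uniform_le`, `trace_sum_regMat_pow`). To bound `W`,
let the sum `M` of these letters act on the indicators of "`π` agrees with `g` on `A`". These
functions span, and `M` is triangular on them. For `o ∉ A` the diagonal part is the scalar `n -
|A|`; for `o ∈ A` it is the same sum of letters restricted to `A`. Ordering by `|A|`, with `o ∈ A`
just below `o ∉ A` at equal size, makes all other terms strictly lower. Since the diagonal part is
symmetric, the trace of an even power of `M` is at most that of the diagonal part, even though the
spanning family is very redundant (`trace_pow_le_of_triangular_lift`). This bounds `W` by explicit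
terms plus the analogous counts for smaller sets (`card_mul_closedWords_le`). Strong induction on
`n` then gives `n! W ≤ n^(2k) (1 + 3 (exp q - 1))` with `q = n^2 exp(-2k/n)`, and `k ≥ n log n + Cn`
forces `q ≤ exp(-2C)`.

On `G ≀ S_n`, fix the word of positions and average over the group elements. If every position
occurs in the word, the product is invariant under each coordinate copy of `G` (`coordInv_wordAlg`),
hence uniform on the fibre over its permutation. The remaining words have proportion at most `n (1 -
1/n)^k ≤ exp(-C)`. So the walk is `ℓ¹`-close to the fibrewise uniform lift of the walk on `S_n`, and
the two errors add up to `4 exp(-C)` (`tvDist_warp_le`). -/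

/-- A projection matrix that is symmetric and idempotent has entries of absolute value at most
one. -/
lemma abs_apply_le_one_of_isSymm_of_idem {Y : Type*} [Fintype Y] {Q : Matrix Y Y ℝ}
    (hs : Qᵀ = Q) (hi : Q * Q = Q) (a b : Y) : |Q a b| ≤ 1 := by
  have hsum : ∀ a, ∑ c, Q a c ^ 2 = Q a a := by
    intro a
    conv_rhs => rw [← hi]
    rw [Matrix.mul_apply]
    refine Finset.sum_congr rfl fun c _ => ?_
    rw [sq]
    congr 1
    conv_rhs => rw [← hs]
    rfl
  have hle : ∀ b, Q a b ^ 2 ≤ Q a a := fun b => by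
    rw [← hsum a]
    exact Finset.single_le_sum (f := fun c => Q a c ^ 2) (fun c _ => sq_nonneg _)
      (Finset.mem_univ b)
  have h1 := hle a
  have h2 := hle b
  have h3 : Q a a ≤ 1 := by nlinarith
  rw [abs_le]
  constructor <;> nlinarith

/-- If `Φ` has independent rows and `M Φ = Φ T`, then the traces of the powers of `M` are those of
the powers of `T` cut down by an orthogonal projection. -/
lemma exists_projection_trace_pow {Z Y : Type*} [Fintype Z] [DecidableEq Z] [Fintype Y]
    [DecidableEq Y] {M : Matrix Z Z ℝ} {Φ : Matrix Z Y ℝ} {T : Matrix Y Y ℝ}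
    (hΦ : ∀ v : Z → ℝ, v ᵥ* Φ = 0 → v = 0) (h : M * Φ = Φ * T) :
    ∃ Q : Matrix Y Y ℝ, Qᵀ = Q ∧ Q * Q = Q ∧ ∀ p : ℕ, (M ^ p).trace = (T ^ p * Q).trace := by
  have hinj : Function.Injective fun v : Z → ℝ => v ᵥ* Φ := by
    intro v w hvw
    have : (v - w) ᵥ* Φ = 0 := by
      rw [Matrix.sub_vecMul]; exact sub_eq_zero.2 hvw
    exact sub_eq_zero.1 (hΦ _ this)
  have hpd : (Φ * Φᵀ).PosDef := by
    have := Matrix.PosDef.mul_conjTranspose_self Φ hinj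
    simpa using this
  have hu : IsUnit (Φ * Φᵀ).det := (Matrix.isUnit_iff_isUnit_det _).1 hpd.isUnit
  have hsym : ((Φ * Φᵀ)⁻¹)ᵀ = (Φ * Φᵀ)⁻¹ := by
    rw [Matrix.transpose_nonsing_inv, Matrix.transpose_mul, Matrix.transpose_transpose]
  have hinv : Φ * (Φᵀ * (Φ * Φᵀ)⁻¹) = 1 := by
    rw [← Matrix.mul_assoc, Matrix.mul_nonsing_inv _ hu]
  -- The orthogonal projection onto the row space of `Φ`; independence of the rows makes the Gram
  -- matrix invertible.
  refine ⟨Φᵀ * (Φ * Φᵀ)⁻¹ * Φ, ?_, ?_, fun p => ?_⟩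
  · rw [Matrix.transpose_mul, Matrix.transpose_mul, hsym, Matrix.transpose_transpose,
      Matrix.mul_assoc]
  · calc Φᵀ * (Φ * Φᵀ)⁻¹ * Φ * (Φᵀ * (Φ * Φᵀ)⁻¹ * Φ)
        = Φᵀ * (Φ * Φᵀ)⁻¹ * (Φ * (Φᵀ * (Φ * Φᵀ)⁻¹)) * Φ := by simp only [Matrix.mul_assoc]
      _ = _ := by rw [hinv, Matrix.mul_one]
  · have hp : M ^ p * Φ = Φ * T ^ p := by
      induction p with
      | zero => simp
      | succ p ih => rw [pow_succ, pow_succ, Matrix.mul_assoc, h, ← Matrix.mul_assoc, ih,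
          Matrix.mul_assoc]
    calc (M ^ p).trace = (M ^ p * (Φ * (Φᵀ * (Φ * Φᵀ)⁻¹))).trace := by rw [hinv, Matrix.mul_one]
      _ = (Φ * (T ^ p * (Φᵀ * (Φ * Φᵀ)⁻¹))).trace := by
          rw [← Matrix.mul_assoc, hp, Matrix.mul_assoc]
      _ = _ := by rw [Matrix.trace_mul_comm]; simp only [Matrix.mul_assoc]

/-- Cutting down an even power of a symmetric matrix by an orthogonal projection does not increase
its trace. -/
lemma trace_pow_mul_projection_le {Y : Type*} [Fintype Y] [DecidableEq Y] {S Q : Matrix Y Y ℝ}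
    (hS : Sᵀ = S) (hs : Qᵀ = Q) (hi : Q * Q = Q) (k : ℕ) :
    (S ^ (2 * k) * Q).trace ≤ (S ^ (2 * k)).trace := by
  have hk : (S ^ k)ᵀ = S ^ k := by rw [Matrix.transpose_pow, hS]
  set R := 1 - Q with hR
  have hRs : Rᵀ = R := by rw [hR, Matrix.transpose_sub, hs, Matrix.transpose_one]
  have hRi : R * R = R := by rw [hR, mul_sub, sub_mul, sub_mul, hi]; simp
  -- With the complementary projection `R`, the trace is the sum of the squared entries of `S ^ k *
  -- R`; this is where the even exponent enters.
  have hnn : 0 ≤ (S ^ (2 * k) * R).trace := by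
    have h1 : (S ^ (2 * k) * R).trace = ((S ^ k * R)ᵀ * (S ^ k * R)).trace := by
      rw [Matrix.transpose_mul, hRs, hk, two_mul, pow_add]
      calc (S ^ k * S ^ k * R).trace = (S ^ k * S ^ k * (R * R)).trace := by rw [hRi]
        _ = ((S ^ k * S ^ k * R) * R).trace := by rw [Matrix.mul_assoc _ R R]
        _ = _ := by rw [Matrix.trace_mul_comm]; simp only [Matrix.mul_assoc]
    rw [h1, Matrix.trace]
    refine Finset.sum_nonneg fun a _ => ?_
    rw [Matrix.diag_apply, Matrix.mul_apply]
    exact Finset.sum_nonneg fun c _ => mul_self_nonneg _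
  rw [hR, mul_sub, mul_one, Matrix.trace_sub] at hnn
  linarith

/-- **Trace bound by a triangular lift.** Let `Φ` have independent rows and suppose that `M` lifts
along `Φ` to `S + N`, where `S` is symmetric and preserves the rank `r`, and `N` strictly lowers
it. Then `tr M ^ (2 k) ≤ tr S ^ (2 k)`. -/
lemma trace_pow_le_of_triangular_lift {Z Y : Type*} [Fintype Z] [DecidableEq Z] [Fintype Y]
    [DecidableEq Y] {M : Matrix Z Z ℝ} {Φ : Matrix Z Y ℝ} {S N : Matrix Y Y ℝ} (r : Y → ℕ)
    (hΦ : ∀ v : Z → ℝ, v ᵥ* Φ = 0 → v = 0) (hS : Sᵀ = S)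
    (hSr : ∀ a b, S a b ≠ 0 → r a = r b) (hN : ∀ a b, N a b ≠ 0 → r a < r b)
    (h : M * Φ = Φ * (S + N)) (k : ℕ) :
    (M ^ (2 * k)).trace ≤ (S ^ (2 * k)).trace := by
  -- Conjugating `S + N` by `diag (t ^ r)` fixes `S` and scales `N` by positive powers of `t`. Hence
  -- `M` also lifts to `T t` for each `t ≠ 0`, and `T t` tends to `S` as `t → 0`.
  let T : ℝ → Matrix Y Y ℝ := fun t => S + Matrix.of fun a b => t ^ (r b - r a) * N a b
  have hT0 : T 0 = S := by
    ext a b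
    by_cases hab : N a b = 0
    · simp [T, hab]
    · have := hN a b hab
      simp [T, zero_pow (Nat.sub_pos_of_lt this).ne']
  have hTc : Continuous T := by
    refine continuous_const.add (continuous_matrix fun a b => ?_)
    simp only [Matrix.of_apply]
    fun_prop
  have hconj : ∀ t : ℝ, Matrix.diagonal (fun a => t ^ r a) * T t
      = (S + N) * Matrix.diagonal (fun a => t ^ r a) := by
    intro t
    ext a b
    rw [Matrix.diagonal_mul, Matrix.mul_diagonal]
    simp only [T, Matrix.add_apply, Matrix.of_apply, mul_add, add_mul]
    congr 1
    · by_cases hab : S a b = 0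
      · simp [hab]
      · rw [hSr a b hab, mul_comm]
    · by_cases hab : N a b = 0
      · simp [hab]
      · rw [← mul_assoc, ← pow_add, Nat.add_sub_cancel' (hN a b hab).le, mul_comm]
  let E : ℝ → ℝ := fun t => ∑ a, ∑ b, |((T t) ^ (2 * k) - S ^ (2 * k)) a b|
  have hbound : ∀ t : ℝ, t ≠ 0 → (M ^ (2 * k)).trace ≤ (S ^ (2 * k)).trace + E t := by
    intro t ht
    have hΦt : ∀ v : Z → ℝ, v ᵥ* (Φ * Matrix.diagonal (fun a => t ^ r a)) = 0 → v = 0 := by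
      intro v hv
      refine hΦ v (funext fun a => ?_)
      have := congrFun hv a
      rw [← Matrix.vecMul_vecMul, Matrix.vecMul_diagonal] at this
      exact (mul_eq_zero.1 this).resolve_right (pow_ne_zero _ ht)
    have hM : M * (Φ * Matrix.diagonal (fun a => t ^ r a))
        = Φ * Matrix.diagonal (fun a => t ^ r a) * T t := by
      rw [← Matrix.mul_assoc, h, Matrix.mul_assoc, Matrix.mul_assoc, hconj]
    -- `Q` depends on `t` without any control as `t → 0`; only the uniform bound on its entries is
    -- used, so no limit of `Q` is needed.
    obtain ⟨Q, hQs, hQi, hQ⟩ := exists_projection_trace_pow hΦt hM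
    have h1 : (M ^ (2 * k)).trace
        = (S ^ (2 * k) * Q).trace + (((T t) ^ (2 * k) - S ^ (2 * k)) * Q).trace := by
      rw [hQ, ← Matrix.trace_add, ← Matrix.add_mul, add_sub_cancel]
    have h2 : (((T t) ^ (2 * k) - S ^ (2 * k)) * Q).trace ≤ E t := by
      rw [Matrix.trace]
      refine Finset.sum_le_sum fun a _ => ?_
      rw [Matrix.diag_apply, Matrix.mul_apply]
      refine Finset.sum_le_sum fun b _ => ?_
      refine (le_abs_self _).trans ?_
      rw [abs_mul]
      exact mul_le_of_le_one_right (abs_nonneg _) (abs_apply_le_one_of_isSymm_of_idem hQs hQi b a)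
    rw [h1]
    exact add_le_add (trace_pow_mul_projection_le hS hQs hQi k) h2
  have hEc : Continuous E := by
    refine continuous_finsetSum _ fun a _ => continuous_finsetSum _ fun b _ => ?_
    exact (((hTc.pow _).sub continuous_const).matrix_elem a b).abs
  have hE0 : E 0 = 0 := by simp [E, hT0]
  have hlim : Tendsto (fun t => (S ^ (2 * k)).trace + E t) (𝓝[≠] 0)
      (𝓝 ((S ^ (2 * k)).trace + 0)) := by
    have hc : Continuous fun t => (S ^ (2 * k)).trace + E t := continuous_const.add hEc
    have h0 := hc.tendsto 0
    simp only [hE0] at h0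
    exact h0.mono_left nhdsWithin_le_nhds
  rw [add_zero] at hlim
  exact ge_of_tendsto hlim (eventually_nhdsWithin_of_forall fun t ht => hbound t ht)

/-- The trace bound by a triangular lift, with the lift given through spanning vectors. -/
lemma trace_pow_le_of_triangular_span {Z Y : Type*} [Fintype Z] [DecidableEq Z] [Fintype Y]
    [DecidableEq Y] {M : Matrix Z Z ℝ} {φ : Y → Z → ℝ} {S : Matrix Y Y ℝ} (r : Y → ℕ)
    (hφ : ∀ v : Z → ℝ, (∀ a, v ⬝ᵥ φ a = 0) → v = 0) (hS : Sᵀ = S)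
    (hSr : ∀ a b, S a b ≠ 0 → r a = r b)
    (h : ∀ b, M *ᵥ φ b - ∑ a, S a b • φ a ∈ Submodule.span ℝ (φ '' {a | r a < r b})) (k : ℕ) :
    (M ^ (2 * k)).trace ≤ (S ^ (2 * k)).trace := by
  have hc : ∀ b, ∃ c : Y →₀ ℝ, (∀ a, c a ≠ 0 → r a < r b) ∧
      ∑ a, c a • φ a = M *ᵥ φ b - ∑ a, S a b • φ a := by
    intro b
    obtain ⟨c, hc, hcs⟩ := (Finsupp.mem_span_image_iff_linearCombination ℝ).1 (h b)
    refine ⟨c, fun a ha => (Finsupp.mem_supported ℝ c).1 hc (Finsupp.mem_support_iff.2 ha), ?_⟩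
    rw [← hcs, Finsupp.linearCombination_apply, Finsupp.sum_fintype _ _ (by simp)]
  choose c hcr hcs using hc
  refine trace_pow_le_of_triangular_lift (Φ := Matrix.of fun z a => φ a z)
    (N := Matrix.of fun a b => c b a) r ?_ hS hSr (fun a b => hcr b a) ?_ k
  · exact fun v hv => hφ v fun a => congrFun hv a
  · ext z b
    have := congrFun (hcs b) z
    simp only [Finset.sum_apply, Pi.smul_apply, Pi.sub_apply, smul_eq_mul] at this
    rw [Matrix.mul_apply, Matrix.mul_apply]
    simp only [Matrix.of_apply, Matrix.add_apply, mul_add, Finset.sum_add_distrib]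
    have h2 : ∑ x, M z x * φ b x = (M *ᵥ φ b) z := rfl
    rw [h2, ← sub_eq_iff_eq_add', ← Finset.sum_congr rfl fun a _ => mul_comm (S a b) (φ a z), ← this]
    exact Finset.sum_congr rfl fun a _ => mul_comm _ _

end WarpShuffle

end

/-! ### The regular representation and closed words -/

noncomputable section

namespace WarpShuffle

open Matrix

/-- Expansion of a power of a sum in a noncommutative semiring over words. -/
lemma sum_pow_eq_sum_words {R ι : Type*} [Semiring R] [Fintype ι] (f : ι → R) (k : ℕ) :
    (∑ i, f i) ^ k = ∑ w : Fin k → ι, (List.ofFn fun i => f (w i)).prod := by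
  induction k with
  | zero => simp
  | succ k ih =>
    rw [pow_succ', ih, Finset.sum_mul_sum, ← (Fin.consEquiv fun _ => ι).sum_comp,
      Fintype.sum_prod_type]
    refine Finset.sum_congr rfl fun i _ => Finset.sum_congr rfl fun w _ => ?_
    simp [List.ofFn_succ, Fin.consEquiv]

/-- The right regular representation of a finite group by permutation matrices. -/
def regMat (Γ : Type*) [Group Γ] [Fintype Γ] [DecidableEq Γ] : Γ →* Matrix Γ Γ ℝ where
  toFun a := Matrix.of fun x y => if x * a = y then 1 else 0
  map_one' := by ext x y; simp [Matrix.one_apply]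
  map_mul' a b := by
    ext x y
    rw [Matrix.mul_apply, Finset.sum_eq_single (x * a)]
    · simp [mul_assoc]
    · intro z _ hz
      simp [hz.symm]
    · simp

lemma regMat_apply {Γ : Type*} [Group Γ] [Fintype Γ] [DecidableEq Γ] (a x y : Γ) :
    regMat Γ a x y = if x * a = y then 1 else 0 := rfl

lemma regMat_mulVec {Γ : Type*} [Group Γ] [Fintype Γ] [DecidableEq Γ] (a : Γ) (v : Γ → ℝ) (x : Γ) :
    (regMat Γ a *ᵥ v) x = v (x * a) := by
  simp [Matrix.mulVec, dotProduct, regMat_apply]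

lemma trace_regMat {Γ : Type*} [Group Γ] [Fintype Γ] [DecidableEq Γ] (a : Γ) :
    (regMat Γ a).trace = if a = 1 then (Fintype.card Γ : ℝ) else 0 := by
  simp [Matrix.trace, regMat_apply]

lemma transpose_regMat {Γ : Type*} [Group Γ] [Fintype Γ] [DecidableEq Γ] (a : Γ) :
    (regMat Γ a)ᵀ = regMat Γ a⁻¹ := by
  ext x y
  rw [Matrix.transpose_apply, regMat_apply, regMat_apply]
  exact if_congr (by rw [mul_inv_eq_iff_eq_mul, eq_comm]) rfl rfl

open Classical in
/-- The number of words of length `p` in the alphabet `ι` whose image in the group is `1`. -/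
def closedWords {Γ ι : Type*} [Group Γ] [Fintype ι] (s : ι → Γ) (p : ℕ) : ℕ :=
  (Finset.univ.filter fun w : Fin p → ι => (List.ofFn fun i => s (w i)).prod = 1).card

/-- Expand the power over words: in the regular representation only the identity has nonzero trace.
-/
lemma trace_sum_regMat_pow {Γ ι : Type*} [Group Γ] [Fintype Γ] [Fintype ι] [DecidableEq Γ]
    (s : ι → Γ) (p : ℕ) :
    ((∑ l, regMat Γ (s l)) ^ p).trace = Fintype.card Γ * closedWords s p := by
  rw [sum_pow_eq_sum_words, Matrix.trace_sum, closedWords, Finset.card_filter]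
  push_cast
  rw [Finset.mul_sum]
  refine Finset.sum_congr rfl fun w _ => ?_
  have : (List.ofFn fun i => regMat Γ (s (w i))).prod
      = regMat Γ (List.ofFn fun i => s (w i)).prod := by
    rw [map_list_prod, List.map_ofFn]; rfl
  rw [this, trace_regMat]
  simp

lemma closedWords_comp_le {Γ ι κ : Type*} [Group Γ] [Fintype ι] [Fintype κ] (s : ι → Γ)
    {f : κ → ι} (hf : Function.Injective f) (p : ℕ) :
    closedWords (s ∘ f) p ≤ closedWords s p := by
  classical
  refine Finset.card_le_card_of_injOn (fun w => f ∘ w) ?_ ?_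
  · intro w hw
    simpa using hw
  · exact fun w _ w' _ h => hf.comp_left h

lemma closedWords_hom {Γ Δ ι : Type*} [Group Γ] [Group Δ] [Fintype ι] (s : ι → Γ)
    {f : Γ →* Δ} (hf : Function.Injective f) (p : ℕ) :
    closedWords (f ∘ s) p = closedWords s p := by
  classical
  unfold closedWords
  congr 1
  refine Finset.filter_congr fun w _ => ?_
  have : (List.ofFn fun i => (f ∘ s) (w i)).prod = f (List.ofFn fun i => s (w i)).prod := by
    rw [map_list_prod, List.map_ofFn]; rfl
  rw [this, map_eq_one_iff f hf]

end WarpShuffle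

end

/-! ### Star transpositions acting on agreement indicators -/

noncomputable section

namespace WarpShuffle

open Matrix Equiv

variable {α : Type*} [DecidableEq α]

/-- The indicator function of the permutations that agree with `g` on `A`. -/
def agreeInd (A : Finset α) (g : α → α) (π : Perm α) : ℝ :=
  if ∀ x ∈ A, π x = g x then 1 else 0

lemma agreeInd_eq_of_iff {A B : Finset α} {g h : α → α} {π ρ : Perm α}
    (H : (∀ x ∈ A, π x = g x) ↔ ∀ x ∈ B, ρ x = h x) : agreeInd A g π = agreeInd B h ρ :=
  if_congr H rfl rfl

lemma agreeInd_congr {A : Finset α} {g g' : α → α} (h : ∀ x ∈ A, g x = g' x) :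
    agreeInd A g = agreeInd A g' := by
  funext π
  exact if_congr (forall₂_congr fun x hx => by rw [h x hx]) rfl rfl

/-- For `l ∈ A.erase o` the swap preserves `A`, so the condition is merely relabelled. For the other
`l` the swap fixes `A.erase o` pointwise, and the condition at `o` becomes `π l = σ o`, which has
exactly one solution; together these `l` contribute the condition on `A.erase o` alone. -/
lemma sum_agreeInd_mul_swap_of_mem [Fintype α] {A : Finset α} {o : α} (ho : o ∈ A)
    (σ π : Perm α) :
    ∑ l, agreeInd A σ (π * swap l o)
      = ∑ l ∈ A.erase o, agreeInd A (σ * swap l o : Perm α) π + agreeInd (A.erase o) σ π := by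
  rw [← Finset.sum_add_sum_compl (A.erase o)]
  congr 1
  · refine Finset.sum_congr rfl fun l hl => agreeInd_eq_of_iff ?_
    have hl' := Finset.mem_of_mem_erase hl
    have hsw : ∀ x ∈ A, swap l o x ∈ A := by
      intro x hx
      rw [swap_apply_def]
      split_ifs <;> assumption
    constructor
    · intro h x hx
      have := h _ (hsw x hx)
      simpa using this
    · intro h x hx
      have := h _ (hsw x hx)
      simpa using this
  · have hfix : ∀ l ∈ (A.erase o)ᶜ, ∀ x ∈ A.erase o, swap l o x = x := by
      intro l hl x hx
      refine swap_apply_of_ne_of_ne ?_ (Finset.ne_of_mem_erase hx)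
      rintro rfl
      exact (Finset.mem_compl.1 hl) hx
    by_cases h : ∀ x ∈ A.erase o, π x = σ x
    · have h1 : agreeInd (A.erase o) σ π = 1 := if_pos h
      -- This solution lies outside `A.erase o`, because `π` and `σ` agree there and `σ` is
      -- injective.
      rw [h1, Finset.sum_eq_single (π⁻¹ (σ o))]
      · refine if_pos fun x hx => ?_
        by_cases hxo : x = o
        · subst hxo; simp
        · have hx' : x ∈ A.erase o := Finset.mem_erase.2 ⟨hxo, hx⟩
          rw [Perm.mul_apply, swap_apply_of_ne_of_ne _ hxo, h x hx']
          intro hx2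
          have h3 : π x = σ o := by rw [hx2]; simp
          rw [h x hx'] at h3
          exact hxo (σ.injective h3)
      · intro l hl hne
        refine if_neg fun hA => hne ?_
        have := hA o ho
        rw [Perm.mul_apply, swap_apply_right] at this
        rw [← this]; simp
      · intro hl
        exfalso
        apply hl
        rw [Finset.mem_compl]
        intro hm
        have := h _ hm
        have h4 : π⁻¹ (σ o) = o := by
          apply σ.injective
          rw [← this]; simp
        exact Finset.ne_of_mem_erase hm h4
    · have h1 : agreeInd (A.erase o) σ π = 0 := if_neg h
      rw [h1]
      refine Finset.sum_eq_zero fun l hl => if_neg fun hA => h fun x hx => ?_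
      have := hA x (Finset.mem_of_mem_erase hx)
      rwa [Perm.mul_apply, hfix l hl x hx] at this

/-- A swap with `l ∉ A` (including `l = o`) does not touch `A`, and there are `n - |A|` of these. A
swap with `l ∈ A` moves the condition at `l` to `o`. -/
lemma sum_agreeInd_mul_swap_of_notMem [Fintype α] {A : Finset α} {o : α} (ho : o ∉ A)
    (g : α → α) (π : Perm α) :
    ∑ l, agreeInd A g (π * swap l o)
      = ((Fintype.card α : ℝ) - A.card) * agreeInd A g π
        + ∑ l ∈ A, agreeInd (insert o (A.erase l)) (g ∘ swap l o) π := by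
  rw [← Finset.sum_add_sum_compl A, add_comm]
  congr 1
  · rw [← Nat.cast_sub (Finset.card_le_univ A), ← Finset.card_compl, ← nsmul_eq_mul,
      ← Finset.sum_const]
    refine Finset.sum_congr rfl fun l hl => agreeInd_eq_of_iff (forall₂_congr fun x hx => ?_)
    rw [Perm.mul_apply, swap_apply_of_ne_of_ne]
    · rintro rfl; exact (Finset.mem_compl.1 hl) hx
    · rintro rfl; exact ho hx
  · refine Finset.sum_congr rfl fun l hl => agreeInd_eq_of_iff ?_
    have hlo : l ≠ o := by rintro rfl; exact ho hl
    constructor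
    · intro h x hx
      rcases Finset.mem_insert.1 hx with rfl | hx'
      · simpa using h l hl
      · have hxo : x ≠ o := by rintro rfl; exact ho (Finset.mem_of_mem_erase hx')
        have := h x (Finset.mem_of_mem_erase hx')
        rw [Perm.mul_apply, swap_apply_of_ne_of_ne (Finset.ne_of_mem_erase hx') hxo] at this
        rw [Function.comp_apply, swap_apply_of_ne_of_ne (Finset.ne_of_mem_erase hx') hxo, this]
    · intro h x hx
      by_cases hxl : x = l
      · subst hxl
        simpa using h o (Finset.mem_insert_self _ _)
      · have hxo : x ≠ o := by rintro rfl; exact ho hx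
        have := h x (Finset.mem_insert_of_mem (Finset.mem_erase.2 ⟨hxl, hx⟩))
        rw [Function.comp_apply, swap_apply_of_ne_of_ne hxl hxo] at this
        rw [Perm.mul_apply, swap_apply_of_ne_of_ne hxl hxo, this]

variable [Fintype α]

/-- Index set of the spanning family of indicator functions on `Perm α`: partial functions
undefined at `o`, and restrictions of permutations to proper subsets containing `o`. -/
abbrev StarIndex (α : Type*) [DecidableEq α] [Fintype α] (o : α) : Type _ :=
  (Σ A : {A : Finset α // o ∉ A}, (A.1 → α)) ⊕
    (Perm α × {A : Finset α // o ∈ A ∧ A ≠ Finset.univ})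

/-- Extension by the identity of a function defined on `A`. -/
def extendFun (A : Finset α) (g : A → α) (x : α) : α := if h : x ∈ A then g ⟨x, h⟩ else x

/-- The spanning family of indicator functions. -/
def starVec (o : α) : StarIndex α o → Perm α → ℝ
  | .inl a => agreeInd a.1.1 (extendFun a.1.1 a.2)
  | .inr b => agreeInd b.2.1 b.1

/-- The rank by which the action of the star transpositions is triangular. -/
def starRank (o : α) : StarIndex α o → ℕ
  | .inl a => 2 * a.1.1.card + 1
  | .inr b => 2 * b.2.1.card

/-- The diagonal part of the action of the star transpositions on the spanning family. -/
def starDiag (o : α) : Matrix (StarIndex α o) (StarIndex α o) ℝ :=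
  Matrix.fromBlocks (Matrix.diagonal fun a => (Fintype.card α : ℝ) - a.1.1.card) 0 0
    (Matrix.blockDiagonal fun A : {A : Finset α // o ∈ A ∧ A ≠ Finset.univ} =>
      ∑ l : {l // l ∈ A.1.erase o}, regMat (Perm α) (swap l.1 o))

lemma agreeInd_eq_starVec_inl {o : α} {A : Finset α} (hA : o ∉ A) (g : α → α) :
    agreeInd A g = starVec o (.inl ⟨⟨A, hA⟩, fun x => g x⟩) :=
  agreeInd_congr fun x hx => by simp [extendFun, hx]

/-- Sets containing `o` are indexed by permutations, so that the diagonal blocks are regular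
representations. A partial function without an extension to a permutation has zero indicator and can
be dropped. -/
lemma agreeInd_eq_zero_or_exists {A : Finset α} (g : α → α) :
    agreeInd A g = 0 ∨ ∃ σ : Perm α, agreeInd A g = agreeInd A σ := by
  by_cases h : ∃ σ : Perm α, ∀ x ∈ A, σ x = g x
  · obtain ⟨σ, hσ⟩ := h
    exact .inr ⟨σ, agreeInd_congr fun x hx => (hσ x hx).symm⟩
  · push Not at h
    left
    funext π
    obtain ⟨x, hx, hne⟩ := h π
    exact if_neg fun h' => hne (h' x hx)

lemma starDiag_transpose (o : α) : (starDiag o)ᵀ = starDiag o := by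
  rw [starDiag, Matrix.fromBlocks_transpose, Matrix.diagonal_transpose,
    Matrix.blockDiagonal_transpose]
  simp only [Matrix.transpose_zero, Matrix.transpose_sum, transpose_regMat, swap_inv]

lemma starRank_eq_of_starDiag_ne_zero {o : α} (a b : StarIndex α o) (h : starDiag o a b ≠ 0) :
    starRank o a = starRank o b := by
  rcases a with a | a <;> rcases b with b | b
  · rw [starDiag, Matrix.fromBlocks_apply₁₁] at h
    by_cases hab : a = b
    · rw [hab]
    · exact absurd (Matrix.diagonal_apply_ne _ hab) h
  · exact absurd rfl h
  · exact absurd rfl h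
  · rw [starDiag, Matrix.fromBlocks_apply₂₂, Matrix.blockDiagonal_apply] at h
    by_cases hab : a.2 = b.2
    · simp [starRank, hab]
    · exact absurd (if_neg hab) h

/-- A permutation is determined by its values off `o`, so `A = univ.erase o` already yields the
point masses. This is why `A = univ`, whose diagonal block would be the full operator again, can be
excluded. -/
lemma eq_zero_of_dotProduct_starVec (o : α) (v : Perm α → ℝ)
    (hv : ∀ a, v ⬝ᵥ starVec o a = 0) : v = 0 := by
  funext σ
  have h := hv (.inl ⟨⟨Finset.univ.erase o, Finset.notMem_erase _ _⟩, fun x => σ x⟩)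
  rw [← agreeInd_eq_starVec_inl, dotProduct, Finset.sum_eq_single σ] at h
  · simpa [agreeInd] using h
  · intro π _ hne
    have : agreeInd (Finset.univ.erase o) σ π = 0 := by
      refine if_neg fun h' => hne ?_
      have hfix : ∀ x, x ≠ o → (σ⁻¹ * π) x = x := fun x hx => by
        rw [Perm.mul_apply, h' x (Finset.mem_erase.2 ⟨hx, Finset.mem_univ x⟩)]; simp
      have hone : σ⁻¹ * π = 1 := by
        ext x
        by_cases hx : x = o
        · subst hx
          by_contra hne'
          have h1 : (σ⁻¹ * π) x ≠ x := hne'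
          have h2 := hfix _ h1
          exact h1 ((σ⁻¹ * π).injective h2)
        · exact hfix x hx
      exact (inv_mul_eq_one.1 hone).symm
    rw [this, mul_zero]
  · simp

/-- A set avoiding `o` leads to sets of the same size containing `o` (rank `2|A| + 1` to `2|A|`),
and a set containing `o` leads to `A.erase o` (rank `2|A|` to `2|A| - 1`). -/
lemma star_triangular (o : α) (b : StarIndex α o) :
    (∑ l, regMat (Perm α) (swap l o)) *ᵥ starVec o b - ∑ a, starDiag o a b • starVec o a
      ∈ Submodule.span ℝ (starVec o '' {a | starRank o a < starRank o b}) := by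
  have hmul : ∀ v : Perm α → ℝ, (∑ l, regMat (Perm α) (swap l o)) *ᵥ v
      = fun π => ∑ l, v (π * swap l o) := by
    intro v
    funext π
    rw [Matrix.sum_mulVec, Finset.sum_apply]
    exact Finset.sum_congr rfl fun l _ => regMat_mulVec _ _ _
  rw [hmul]
  rcases b with ⟨⟨A, hA⟩, g⟩ | ⟨σ, A, hA, hAu⟩
  · have hd : ∑ a, starDiag o a (.inl ⟨⟨A, hA⟩, g⟩) • starVec o a
        = ((Fintype.card α : ℝ) - A.card) • agreeInd A (extendFun A g) := by
      rw [Finset.sum_eq_single (.inl ⟨⟨A, hA⟩, g⟩)]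
      · simp [starDiag, starVec]
      · rintro (a | a) _ hne
        · rw [starDiag, Matrix.fromBlocks_apply₁₁, Matrix.diagonal_apply_ne, zero_smul]
          exact fun h => hne (congrArg _ h)
        · simp [starDiag]
      · simp
    rw [hd]
    have heq : (fun π => ∑ l, agreeInd A (extendFun A g) (π * swap l o))
        - ((Fintype.card α : ℝ) - A.card) • agreeInd A (extendFun A g)
        = ∑ l ∈ A, agreeInd (insert o (A.erase l)) (extendFun A g ∘ swap l o) := by
      funext π
      rw [Pi.sub_apply, sum_agreeInd_mul_swap_of_notMem hA, Pi.smul_apply, smul_eq_mul,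
        add_sub_cancel_left, Finset.sum_apply]
    change (fun π => ∑ l, agreeInd A (extendFun A g) (π * swap l o)) - _ ∈ _
    rw [heq]
    refine Submodule.sum_mem _ fun l hl => ?_
    rcases agreeInd_eq_zero_or_exists (A := insert o (A.erase l)) (extendFun A g ∘ swap l o)
      with h0 | ⟨σ, hσ⟩
    · rw [h0]; exact Submodule.zero_mem _
    · rw [hσ]
      have hlo : l ≠ o := by rintro rfl; exact hA hl
      refine Submodule.subset_span ⟨.inr (σ, ⟨insert o (A.erase l), Finset.mem_insert_self _ _,
        fun hu => ?_⟩), ?_, rfl⟩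
      · have : l ∈ insert o (A.erase l) := by rw [hu]; exact Finset.mem_univ l
        simp [hlo] at this
      · have hc : (insert o (A.erase l)).card = A.card := by
          rw [Finset.card_insert_of_notMem fun h => hA (Finset.mem_of_mem_erase h),
            Finset.card_erase_add_one hl]
        simp [starRank, hc]
  · have hd : ∑ a, starDiag o a (.inr (σ, ⟨A, hA, hAu⟩)) • starVec o a
        = ∑ l ∈ A.erase o, agreeInd A (σ * swap l o : Perm α) := by
      rw [Fintype.sum_sum_type]
      have h1 : ∑ a, starDiag o (.inl a) (.inr (σ, ⟨A, hA, hAu⟩)) • starVec o (.inl a) = 0 :=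
        Finset.sum_eq_zero fun a _ => by simp [starDiag]
      rw [h1, zero_add, Fintype.sum_prod_type]
      have h2 : ∀ τ : Perm α, ∑ B : {A : Finset α // o ∈ A ∧ A ≠ Finset.univ},
          starDiag o (.inr (τ, B)) (.inr (σ, ⟨A, hA, hAu⟩)) • starVec o (.inr (τ, B))
          = ∑ l ∈ A.erase o, (if τ * swap l o = σ then (1 : ℝ) else 0) • agreeInd A τ := by
        intro τ
        rw [Finset.sum_eq_single ⟨A, hA, hAu⟩]
        · rw [starDiag, Matrix.fromBlocks_apply₂₂, Matrix.blockDiagonal_apply, if_pos rfl,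
            Matrix.sum_apply, Finset.sum_smul]
          rw [← Finset.sum_coe_sort (A.erase o)]
          rfl
        · intro B _ hB
          rw [starDiag, Matrix.fromBlocks_apply₂₂, Matrix.blockDiagonal_apply, if_neg hB,
            zero_smul]
        · simp
      simp only [h2]
      rw [Finset.sum_comm]
      refine Finset.sum_congr rfl fun l _ => ?_
      rw [Finset.sum_eq_single (σ * swap l o)]
      · simp [mul_assoc]
      · intro τ _ hne
        rw [if_neg, zero_smul]
        rintro rfl
        exact hne (by simp [mul_assoc])
      · simp
    rw [hd]
    have heq : (fun π => ∑ l, agreeInd A σ (π * swap l o))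
        - ∑ l ∈ A.erase o, agreeInd A (σ * swap l o : Perm α) = agreeInd (A.erase o) σ := by
      funext π
      rw [Pi.sub_apply, sum_agreeInd_mul_swap_of_mem hA, Finset.sum_apply, add_sub_cancel_left]
    change (fun π => ∑ l, agreeInd A σ (π * swap l o)) - _ ∈ _
    rw [heq, agreeInd_eq_starVec_inl (Finset.notMem_erase o A)]
    refine Submodule.subset_span ⟨_, ?_, rfl⟩
    have := Finset.card_erase_add_one hA
    simp only [starRank, Set.mem_ofPred_eq]
    omega

lemma trace_fromBlocks_eq_add {m n : Type*} [Fintype m] [Fintype n] (A : Matrix m m ℝ)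
    (B : Matrix m n ℝ) (C : Matrix n m ℝ) (D : Matrix n n ℝ) :
    (Matrix.fromBlocks A B C D).trace = A.trace + D.trace := by
  simp [Matrix.trace, Fintype.sum_sum_type]

/-- Recursive bound for the number of closed words in the star transpositions. -/
lemma card_mul_closedWords_le (o : α) (k : ℕ) :
    (Fintype.card (Perm α) : ℝ) * closedWords (fun l : α => swap l o) (2 * k)
      ≤ ∑ A : {A : Finset α // o ∉ A},
          (Fintype.card α : ℝ) ^ A.1.card * ((Fintype.card α : ℝ) - A.1.card) ^ (2 * k)
        + ∑ A : {A : Finset α // o ∈ A ∧ A ≠ Finset.univ},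
          (Fintype.card (Perm α) : ℝ) *
            closedWords (fun l : {l // l ∈ A.1.erase o} => swap l.1 o) (2 * k) := by
  rw [← trace_sum_regMat_pow]
  refine (trace_pow_le_of_triangular_span (starRank o) (eq_zero_of_dotProduct_starVec o)
    (starDiag_transpose o) starRank_eq_of_starDiag_ne_zero (star_triangular o) k).trans_eq ?_
  rw [starDiag, Matrix.fromBlocks_diagonal_pow, trace_fromBlocks_eq_add, Matrix.diagonal_pow,
    ← Matrix.blockDiagonal_pow, Matrix.trace_blockDiagonal, Matrix.trace_diagonal]
  congr 1
  · rw [Fintype.sum_sigma]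
    refine Finset.sum_congr rfl fun A _ => ?_
    simp
  · exact Finset.sum_congr rfl fun A _ => trace_sum_regMat_pow _ _

end WarpShuffle

end

/-! ### Counting closed words, and mixing on the symmetric group -/

noncomputable section

namespace WarpShuffle

open Matrix Equiv

lemma exp_sub_one_le_of_le {q : ℝ} (h0 : 0 ≤ q) (h1 : q ≤ 1 / 7) :
    Real.exp q - 1 ≤ 8 / 7 * q := by
  have := Real.abs_exp_sub_one_sub_id_le (x := q) (by rw [abs_of_nonneg h0]; linarith)
  have := (abs_le.1 this).2
  nlinarith

lemma sub_pow_le_mul_exp {n b : ℝ} (hn : 0 < n) (hb : b ≤ n) (p : ℕ) :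
    (n - b) ^ p ≤ n ^ p * Real.exp (-(p * b / n)) := by
  have h1 : n - b ≤ n * Real.exp (-(b / n)) := by
    have h2 := Real.add_one_le_exp (-(b / n))
    have h3 : n - b = n * (-(b / n) + 1) := by field_simp; ring
    rw [h3]
    exact mul_le_mul_of_nonneg_left h2 hn.le
  calc (n - b) ^ p ≤ (n * Real.exp (-(b / n))) ^ p := pow_le_pow_left₀ (by linarith) h1 p
    _ = n ^ p * Real.exp (-(p * b / n)) := by
      rw [mul_pow, ← Real.exp_nat_mul]; congr 2; ring

lemma sum_pow_card_notMem {α : Type*} [Fintype α] [DecidableEq α] (o : α) (x : ℝ) :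
    ∑ A : {A : Finset α // o ∉ A}, x ^ A.1.card = (x + 1) ^ (Fintype.card α - 1) := by
  have h := Finset.sum_pow_mul_eq_add_pow x 1 (Finset.univ.erase o)
  rw [Finset.card_erase_of_mem (Finset.mem_univ o), Finset.card_univ] at h
  rw [← h]
  simp only [one_pow, mul_one]
  exact (Finset.sum_subtype (p := fun A : Finset α => o ∉ A) _
    (fun A => by simp [Finset.mem_powerset, Finset.subset_erase])
    (fun A : Finset α => x ^ A.card)).symm

lemma sum_pow_card_compl {α : Type*} [Fintype α] [DecidableEq α] (o : α) (x : ℝ) :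
    ∑ A : {A : Finset α // o ∈ A ∧ A ≠ Finset.univ}, x ^ (Fintype.card α - A.1.card)
      = (x + 1) ^ (Fintype.card α - 1) - 1 := by
  have h1 : ∑ A : {A : Finset α // o ∈ A}, x ^ (Fintype.card α - A.1.card)
      = (x + 1) ^ (Fintype.card α - 1) := by
    rw [← sum_pow_card_notMem o x]
    refine Fintype.sum_equiv (Equiv.subtypeEquiv
      (Function.Involutive.toPerm (fun A : Finset α => Aᶜ) compl_involutive)
      fun A => by simp [Function.Involutive.toPerm]) _ _ fun A => ?_
    rw [← Finset.card_compl]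
    rfl
  rw [← h1]
  have h2 : ∑ A : {A : Finset α // o ∈ A}, x ^ (Fintype.card α - A.1.card)
      = ∑ A ∈ Finset.univ.filter (fun A : Finset α => o ∈ A), x ^ (Fintype.card α - A.card) :=
    (Finset.sum_subtype (p := fun A : Finset α => o ∈ A) _ (fun A => by simp)
      (fun A : Finset α => x ^ (Fintype.card α - A.card))).symm
  have h3 : ∑ A : {A : Finset α // o ∈ A ∧ A ≠ Finset.univ}, x ^ (Fintype.card α - A.1.card)
      = ∑ A ∈ (Finset.univ.filter (fun A : Finset α => o ∈ A)).erase Finset.univ,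
        x ^ (Fintype.card α - A.card) :=
    (Finset.sum_subtype (p := fun A : Finset α => o ∈ A ∧ A ≠ Finset.univ) _
      (fun A => by simp [and_comm]) (fun A : Finset α => x ^ (Fintype.card α - A.card))).symm
  rw [h2, h3, Finset.sum_erase_eq_sub (by simp)]
  simp

/-- Adding the letter `l = o`, the identity, only increases the count and gives the full star on
`A`, to which the induction hypothesis applies. -/
lemma closedWords_subset_le {α : Type*} [Fintype α] [DecidableEq α] {o : α} {A : Finset α}
    (ho : o ∈ A) (p : ℕ) :
    closedWords (fun l : {l // l ∈ A.erase o} => swap l.1 o) p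
      ≤ closedWords (fun l : A => swap l ⟨o, ho⟩) p := by
  have h1 := closedWords_comp_le (fun l : A => swap l.1 o)
    (f := fun l : {l // l ∈ A.erase o} => (⟨l.1, Finset.mem_of_mem_erase l.2⟩ : A))
    (fun a b h => Subtype.ext (by simpa using h)) p
  have h2 := closedWords_hom (fun l : A => swap l ⟨o, ho⟩)
    (f := Perm.ofSubtype (p := fun x => x ∈ A)) Perm.ofSubtype_injective p
  rw [← h2]
  refine h1.trans_eq ?_
  congr 1
  funext l
  exact (Perm.ofSubtype_swap_eq l ⟨o, ho⟩).symm

/-- Passes the smallness condition on `n ^ 2 * exp (-2k / n)` down to subsets in the induction. -/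
lemma sq_mul_exp_mono {a b : ℕ} (ha : 0 < a) (hab : a ≤ b) (k : ℕ) :
    (a : ℝ) ^ 2 * Real.exp (-((2 * k : ℕ) / (a : ℝ)))
      ≤ (b : ℝ) ^ 2 * Real.exp (-((2 * k : ℕ) / (b : ℝ))) := by
  have ha' : (0 : ℝ) < a := by exact_mod_cast ha
  have hab' : (a : ℝ) ≤ b := by exact_mod_cast hab
  gcongr

/-- The number of closed words of length `2 k` in the star transpositions exceeds its average value
`n ^ (2 k) / n!` by a factor close to one once `n ^ 2 exp (- 2 k / n)` is small. -/
theorem card_mul_closedWords_star_le {α : Type*} [Fintype α] [DecidableEq α] (o : α) (k : ℕ)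
    (hq : (Fintype.card α : ℝ) ^ 2 * Real.exp (-((2 * k : ℕ) / (Fintype.card α : ℝ))) ≤ 1 / 7) :
    (Fintype.card (Perm α) : ℝ) * closedWords (fun l : α => swap l o) (2 * k)
      ≤ (Fintype.card α : ℝ) ^ (2 * k) * (1 + 3 * (Real.exp ((Fintype.card α : ℝ) ^ 2 *
          Real.exp (-((2 * k : ℕ) / (Fintype.card α : ℝ)))) - 1)) := by
  induction hm : Fintype.card α using Nat.strong_induction_on generalizing α with
  | _ m ih =>
  subst hm
  have hpos : 0 < Fintype.card α := Fintype.card_pos_iff.2 ⟨o⟩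
  set n : ℝ := (Fintype.card α : ℝ) with hn
  have hn0 : 0 < n := by rw [hn]; exact_mod_cast hpos
  set p := 2 * k with hp
  set y := Real.exp (-((p : ℕ) / n)) with hy
  have hy0 : 0 < y := Real.exp_pos _
  have hx0 : 0 ≤ n * y := by positivity
  have hyb : ∀ b : ℕ, Real.exp (-((p : ℝ) * b / n)) = y ^ b := by
    intro b
    rw [hy, ← Real.exp_nat_mul]; congr 1; ring
  have hF : (n * y + 1) ^ (Fintype.card α - 1) ≤ Real.exp (n ^ 2 * y) := by
    calc (n * y + 1) ^ (Fintype.card α - 1) ≤ (n * y + 1) ^ (Fintype.card α) :=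
          pow_le_pow_right₀ (by linarith) (Nat.sub_le _ _)
      _ ≤ (Real.exp (n * y)) ^ (Fintype.card α) :=
          pow_le_pow_left₀ (by linarith) (Real.add_one_le_exp _) _
      _ = Real.exp (n ^ 2 * y) := by rw [← Real.exp_nat_mul]; congr 1; rw [← hn]; ring
  have hsum1 : ∑ A : {A : Finset α // o ∉ A}, n ^ A.1.card * (n - A.1.card) ^ p
      ≤ n ^ p * (n * y + 1) ^ (Fintype.card α - 1) := by
    rw [← sum_pow_card_notMem o, Finset.mul_sum]
    refine Finset.sum_le_sum fun A _ => ?_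
    have hle : (A.1.card : ℝ) ≤ n := by rw [hn]; exact_mod_cast Finset.card_le_univ A.1
    have := sub_pow_le_mul_exp hn0 hle p
    rw [hyb] at this
    calc n ^ A.1.card * (n - A.1.card) ^ p ≤ n ^ A.1.card * (n ^ p * y ^ A.1.card) := by gcongr
      _ = n ^ p * (n * y) ^ A.1.card := by rw [mul_pow]; ring
  have hsum2 : ∑ A : {A : Finset α // o ∈ A ∧ A ≠ Finset.univ},
      (Fintype.card (Perm α) : ℝ) *
        closedWords (fun l : {l // l ∈ A.1.erase o} => swap l.1 o) p
      ≤ 2 * n ^ p * ((n * y + 1) ^ (Fintype.card α - 1) - 1) := by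
    rw [← sum_pow_card_compl o, Finset.mul_sum]
    refine Finset.sum_le_sum fun A _ => ?_
    obtain ⟨A, hA, hAu⟩ := A
    have hlt : A.card < Fintype.card α := (Finset.card_lt_iff_ne_univ A).2 hAu
    have hcA : 0 < A.card := Finset.card_pos.2 ⟨o, hA⟩
    have hmono := sq_mul_exp_mono hcA hlt.le k
    have hcard : Fintype.card A = A.card := Fintype.card_coe A
    have hqA : (A.card : ℝ) ^ 2 * Real.exp (-((2 * k : ℕ) / (A.card : ℝ))) ≤ 1 / 7 :=
      hmono.trans hq
    have hIH := ih A.card hlt (α := A) ⟨o, hA⟩ (by rw [hcard]; exact hqA) hcard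
    -- The crude factor `2` suffices here: `3 * (8 / 7) * (1 / 7) ≤ 1`.
    have hbd : (A.card : ℝ) ^ p * (1 + 3 * (Real.exp ((A.card : ℝ) ^ 2 *
          Real.exp (-((2 * k : ℕ) / (A.card : ℝ)))) - 1)) ≤ (A.card : ℝ) ^ p * 2 := by
      have := exp_sub_one_le_of_le (by positivity) hqA
      gcongr
      linarith
    have hIH2 := hIH.trans hbd
    have hw : (closedWords (fun l : {l // l ∈ A.erase o} => swap l.1 o) p : ℝ)
        ≤ closedWords (fun l : A => swap l ⟨o, hA⟩) p := by
      exact_mod_cast closedWords_subset_le hA p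
    rw [Fintype.card_perm, hcard] at hIH2
    set b := Fintype.card α - A.card with hb
    have hAb : (A.card : ℝ) = n - b := by
      rw [hb, Nat.cast_sub hlt.le, ← hn]; ring
    -- Each of the `b` missing points costs a factor `n` from the factorial and gains a factor `y`
    -- from `(n - b) ^ p`, so the total is again a power of `n * y`.
    have hfac : ((Fintype.card α).factorial : ℝ) ≤ n ^ b * (A.card).factorial := by
      have h1 := Nat.factorial_mul_descFactorial (n := Fintype.card α) (k := b) (Nat.sub_le _ _)
      have h2 : Fintype.card α - b = A.card := by omega
      rw [h2] at h1
      rw [← h1, hn, mul_comm]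
      push_cast
      gcongr
      exact_mod_cast Nat.descFactorial_le_pow _ _
    have hsp := sub_pow_le_mul_exp hn0 (b := b) (by
      have : (0 : ℝ) ≤ A.card := by positivity
      linarith) p
    rw [hyb, ← hAb] at hsp
    rw [Fintype.card_perm]
    calc ((Fintype.card α).factorial : ℝ) *
          closedWords (fun l : {l // l ∈ A.erase o} => swap l.1 o) p
        ≤ (n ^ b * (A.card).factorial) * closedWords (fun l : A => swap l ⟨o, hA⟩) p := by
          gcongr
      _ = n ^ b * ((A.card).factorial * closedWords (fun l : A => swap l ⟨o, hA⟩) p) := by ring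
      _ ≤ n ^ b * ((A.card : ℝ) ^ p * 2) := by gcongr
      _ ≤ n ^ b * ((n ^ p * y ^ b) * 2) := by gcongr
      _ = 2 * n ^ p * (n * y) ^ b := by rw [mul_pow]; ring
  -- With `F = (n * y + 1) ^ (card α - 1)` the two sums give `F + 2 * (F - 1) = 1 + 3 * (F - 1)`.
  refine (card_mul_closedWords_le o k).trans ((add_le_add hsum1 hsum2).trans ?_)
  have hnp : 0 ≤ n ^ p := by positivity
  nlinarith

/-! ### Convolution powers on a finite group -/

/-- The matrix of right convolution. -/
def convMat {Γ : Type*} [Group Γ] (p : Γ → ℝ) : Matrix Γ Γ ℝ := Matrix.of fun x y => p (x⁻¹ * y)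

lemma convMat_conv {Γ : Type*} [Group Γ] [Fintype Γ] (p q : Γ → ℝ) :
    convMat (conv p q) = convMat p * convMat q := by
  ext x z
  rw [Matrix.mul_apply]
  simp only [convMat, Matrix.of_apply, conv]
  refine Fintype.sum_equiv ((Equiv.inv Γ).trans (Equiv.mulLeft z)) _ _ fun y => ?_
  simp [mul_assoc]

lemma convMat_convPow {Γ : Type*} [Group Γ] [Fintype Γ] [DecidableEq Γ] (p : Γ → ℝ) (k : ℕ) :
    convMat (convPow p k) = convMat p ^ k := by
  induction k with
  | zero =>
    ext x y
    simp [convMat, convPow, Matrix.one_apply, inv_mul_eq_one]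
  | succ k ih => rw [pow_succ, ← ih, ← convMat_conv]; rfl

lemma sum_conv {Γ : Type*} [Group Γ] [Fintype Γ] (p q : Γ → ℝ) :
    ∑ x, conv p q x = (∑ x, p x) * ∑ x, q x := by
  unfold conv
  rw [Finset.sum_comm, Finset.mul_sum]
  refine Finset.sum_congr rfl fun y _ => ?_
  rw [← Finset.sum_mul]
  congr 1
  exact Equiv.sum_comp (Equiv.mulRight y⁻¹) p

lemma sum_convPow {Γ : Type*} [Group Γ] [Fintype Γ] {p : Γ → ℝ} (hp : ∑ x, p x = 1) (k : ℕ) :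
    ∑ x, convPow p k x = 1 := by
  induction k with
  | zero => classical rw [Finset.sum_eq_single 1] <;> simp +contextual [convPow]
  | succ k ih =>
    change ∑ x, conv (convPow p k) p x = 1
    rw [sum_conv, ih, hp, one_mul]

/-- The upper bound lemma: for a symmetric measure the `ℓ¹`-distance to uniformity is controlled by
a trace. -/
lemma sq_sum_abs_sub_uniform_le {Γ : Type*} [Group Γ] [Fintype Γ] [DecidableEq Γ] {p : Γ → ℝ}
    (hp : ∑ x, p x = 1) (hsymm : (convMat p)ᵀ = convMat p) (k : ℕ) :
    (∑ x, |convPow p k x - uniform Γ x|) ^ 2 ≤ (convMat p ^ (2 * k)).trace - 1 := by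
  have hN : (0 : ℝ) < Fintype.card Γ := by exact_mod_cast Fintype.card_pos
  have htr : (convMat p ^ (2 * k)).trace = Fintype.card Γ * ∑ x, convPow p k x ^ 2 := by
    have hs : (convMat p ^ k)ᵀ = convMat p ^ k := by rw [Matrix.transpose_pow, hsymm]
    rw [two_mul, pow_add]
    nth_rewrite 2 [← hs]
    rw [← convMat_convPow, Matrix.trace]
    have : ∀ x : Γ, (convMat (convPow p k) * (convMat (convPow p k))ᵀ).diag x
        = ∑ y, convPow p k y ^ 2 := by
      intro x
      rw [Matrix.diag_apply, Matrix.mul_apply,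
        ← Equiv.sum_comp (Equiv.mulLeft x⁻¹) fun y => convPow p k y ^ 2]
      refine Finset.sum_congr rfl fun y _ => ?_
      rw [sq]; rfl
    rw [Finset.sum_congr rfl fun x _ => this x]
    simp
  have hsum := sum_convPow hp k
  have hsq : ∑ x, (convPow p k x - uniform Γ x) ^ 2
      = ∑ x, convPow p k x ^ 2 - 1 / Fintype.card Γ := by
    have : ∀ x, (convPow p k x - uniform Γ x) ^ 2
        = convPow p k x ^ 2 - 2 / Fintype.card Γ * convPow p k x
          + (1 / (Fintype.card Γ : ℝ)) ^ 2 := fun x => by rw [uniform]; ring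
    rw [Finset.sum_congr rfl fun x _ => this x, Finset.sum_add_distrib, Finset.sum_sub_distrib,
      ← Finset.mul_sum, hsum]
    simp
    field_simp
    ring
  calc (∑ x, |convPow p k x - uniform Γ x|) ^ 2
      ≤ Fintype.card Γ * ∑ x, |convPow p k x - uniform Γ x| ^ 2 := by
        have := sq_sum_le_card_mul_sum_sq (s := Finset.univ)
          (f := fun x => |convPow p k x - uniform Γ x|)
        simpa using this
    _ = _ := by
      simp only [sq_abs]
      rw [hsq, htr]
      field_simp

lemma tvDist_le_sum_abs {Ω : Type*} [Fintype Ω] (μ ν : Ω → ℝ) :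
    tvDist μ ν ≤ ∑ x, |μ x - ν x| := by
  refine ciSup_le fun A => ?_
  rw [← Finset.sum_sub_distrib]
  exact (Finset.abs_sum_le_sum_abs _ _).trans
    (Finset.sum_le_sum_of_subset_of_nonneg (Finset.subset_univ A) fun _ _ _ => abs_nonneg _)

lemma tvDist_nonneg {Ω : Type*} [Fintype Ω] (μ ν : Ω → ℝ) : 0 ≤ tvDist μ ν :=
  Real.iSup_nonneg fun _ => abs_nonneg _

/-! ### The transpose top with random shuffle -/

lemma transposeTopMeasure_eq_sum (n : ℕ+) (π : Perm (Fin n)) :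
    transposeTopMeasure n π = (1 / (n : ℝ)) * ∑ l, if swap l (top n) = π then (1 : ℝ) else 0 := by
  classical
  have hinj : ∀ l l' : Fin n, swap l (top n) = swap l' (top n) → l = l' := by
    intro l l' h
    have := congrArg (fun s : Perm (Fin n) => s (top n)) h
    simpa using this
  unfold transposeTopMeasure
  by_cases h : ∃ l, swap l (top n) = π
  · obtain ⟨l, hl⟩ := h
    rw [Finset.sum_eq_single l, if_pos hl, mul_one, if_pos]
    · by_cases hlt : l = top n
      · left; rw [← hl, hlt, swap_self]; rfl
      · exact .inr ⟨l, hlt, hl.symm⟩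
    · intro l' _ hne
      exact if_neg fun h' => hne (hinj _ _ (h'.trans hl.symm))
    · simp
  · rw [Finset.sum_eq_zero, mul_zero, if_neg]
    · rintro (rfl | ⟨l, _, rfl⟩)
      · exact h ⟨top n, swap_self _⟩
      · exact h ⟨l, rfl⟩
    · exact fun l _ => if_neg fun h' => h ⟨l, h'⟩

lemma convMat_transposeTopMeasure (n : ℕ+) :
    convMat (transposeTopMeasure n)
      = (1 / (n : ℝ)) • ∑ l, regMat (Perm (Fin n)) (swap l (top n)) := by
  ext x y
  rw [Matrix.smul_apply, Matrix.sum_apply]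
  simp only [convMat, Matrix.of_apply, transposeTopMeasure_eq_sum, regMat_apply, smul_eq_mul,
    eq_inv_mul_iff_mul_eq]

lemma sum_transposeTopMeasure (n : ℕ+) : ∑ π, transposeTopMeasure n π = 1 := by
  simp only [transposeTopMeasure_eq_sum]
  rw [← Finset.mul_sum, Finset.sum_comm]
  simp

/-- Mixing of the transpose top with random shuffle, in `ℓ¹`-distance. -/
theorem sum_abs_transposeTop_sub_uniform_le (n : ℕ+) {C : ℝ} (hC : 1 < C) {k : ℕ}
    (hk : (n : ℝ) * Real.log n + C * n ≤ k) :
    ∑ π, |convPow (transposeTopMeasure n) k π - uniform (Perm (Fin n)) π|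
      ≤ 2 * Real.exp (-C) := by
  have hn : (0 : ℝ) < n := by exact_mod_cast n.pos
  set q := (n : ℝ) ^ 2 * Real.exp (-((2 * k : ℕ) / (n : ℝ))) with hqdef
  have hq0 : 0 ≤ q := by positivity
  have hqC : q ≤ Real.exp (-C) ^ 2 := by
    have h1 : Real.exp (-((2 * k : ℕ) / (n : ℝ)))
        ≤ Real.exp (-(2 * Real.log n) + -(2 * C)) := by
      apply Real.exp_le_exp.2
      have : Real.log n + C ≤ k / n := by
        rw [le_div_iff₀ hn]; linarith
      push_cast
      rw [mul_div_assoc]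
      linarith
    rw [Real.exp_add, Real.exp_neg (2 * Real.log n), two_mul (Real.log n), Real.exp_add,
      Real.exp_log hn] at h1
    have h2 : Real.exp (-C) ^ 2 = Real.exp (-(2 * C)) := by
      rw [← Real.exp_nat_mul]; congr 1; push_cast; ring
    rw [h2, hqdef]
    calc (n : ℝ) ^ 2 * Real.exp (-((2 * k : ℕ) / (n : ℝ)))
        ≤ (n : ℝ) ^ 2 * (((n : ℝ) * n)⁻¹ * Real.exp (-(2 * C))) := by gcongr
      _ = _ := by field_simp
  -- `C > 1` gives `q < exp (-2)`, which is just below `1 / 7`.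
  have hq7 : q ≤ 1 / 7 := by
    have h1 : Real.exp (-C) ≤ Real.exp (-1) := Real.exp_le_exp.2 (by linarith)
    have h2 : Real.exp (-1) < 0.3679 := by
      have := Real.exp_neg_one_lt_d9; linarith
    have h3 : 0 < Real.exp (-C) := Real.exp_pos _
    nlinarith
  have hcw := card_mul_closedWords_star_le (top n) k (by rw [Fintype.card_fin]; exact hq7)
  simp only [Fintype.card_fin] at hcw
  have hsymm : (convMat (transposeTopMeasure n))ᵀ = convMat (transposeTopMeasure n) := by
    rw [convMat_transposeTopMeasure, Matrix.transpose_smul, Matrix.transpose_sum]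
    simp only [transpose_regMat, swap_inv]
  have hub := sq_sum_abs_sub_uniform_le (sum_transposeTopMeasure n) hsymm k
  have htr : (convMat (transposeTopMeasure n) ^ (2 * k)).trace
      ≤ 1 + 3 * (Real.exp q - 1) := by
    rw [convMat_transposeTopMeasure, smul_pow, Matrix.trace_smul, trace_sum_regMat_pow,
      smul_eq_mul, one_div, inv_pow, inv_mul_le_iff₀ (by positivity)]
    exact hcw
  have hexp := exp_sub_one_le_of_le hq0 hq7
  -- The squared distance is at most `3 * (8 / 7) * q ≤ 4 * exp (-C) ^ 2`.
  refine abs_le_of_sq_le_sq' ?_ (by positivity) |>.2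
  rw [mul_pow]
  linarith

end WarpShuffle

end

noncomputable section

namespace WarpShuffle

open Equiv

/-! ### The group algebra and the `ℓ¹`-norm -/

/-- A function on a finite group as an element of the group algebra. -/
def toAlg {Γ : Type*} [Fintype Γ] (p : Γ → ℝ) : MonoidAlgebra ℝ Γ :=
  .ofCoeff (Finsupp.equivFunOnFinite.symm p)

@[simp] lemma coeff_toAlg {Γ : Type*} [Fintype Γ] (p : Γ → ℝ) (x : Γ) :
    (toAlg p).coeff x = p x := rfl

lemma toAlg_conv {Γ : Type*} [Group Γ] [Fintype Γ] (p q : Γ → ℝ) :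
    toAlg (conv p q) = toAlg p * toAlg q := by
  classical
  ext x
  rw [MonoidAlgebra.coeff_mul, Finsupp.sum_fintype _ _ (by simp)]
  have : ∀ a, ((toAlg q).coeff.sum fun b r => if a * b = x then (toAlg p).coeff a * r else 0)
      = ∑ b, if a * b = x then p a * q b else 0 := fun a =>
    Finsupp.sum_fintype _ _ (by simp)
  rw [Finset.sum_congr rfl fun a _ => this a, Finset.sum_comm, coeff_toAlg, conv]
  refine Finset.sum_congr rfl fun b _ => ?_
  rw [Finset.sum_eq_single (x * b⁻¹)]
  · simp
  · intro a _ hne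
    exact if_neg fun h => hne (eq_mul_inv_of_mul_eq h)
  · simp

lemma toAlg_convPow {Γ : Type*} [Group Γ] [Fintype Γ] (p : Γ → ℝ) (k : ℕ) :
    toAlg (convPow p k) = toAlg p ^ k := by
  classical
  induction k with
  | zero =>
    ext x
    rw [pow_zero, MonoidAlgebra.one_def, MonoidAlgebra.coeff_single, Finsupp.single_apply]
    simp [convPow, eq_comm]
  | succ k ih => rw [pow_succ, ← ih, ← toAlg_conv]; rfl

/-- The `ℓ¹`-norm on the group algebra. -/
def algL1 {Γ : Type*} [Fintype Γ] (m : MonoidAlgebra ℝ Γ) : ℝ := ∑ x, |m.coeff x|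

lemma algL1_of {Γ : Type*} [Group Γ] [Fintype Γ] (a : Γ) :
    algL1 (MonoidAlgebra.of ℝ Γ a) = 1 := by
  classical
  rw [algL1, Finset.sum_eq_single a]
  · simp
  · intro b _ hb
    simp [hb.symm]
  · simp

lemma algL1_sum_le {Γ ι : Type*} [Fintype Γ] (s : Finset ι) (f : ι → MonoidAlgebra ℝ Γ) :
    algL1 (∑ i ∈ s, f i) ≤ ∑ i ∈ s, algL1 (f i) := by
  unfold algL1
  rw [Finset.sum_comm]
  refine Finset.sum_le_sum fun x _ => ?_
  rw [MonoidAlgebra.coeff_sum, Finsupp.finsetSum_apply]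
  exact Finset.abs_sum_le_sum_abs _ _

lemma algL1_smul {Γ : Type*} [Fintype Γ] (r : ℝ) (m : MonoidAlgebra ℝ Γ) :
    algL1 (r • m) = |r| * algL1 m := by
  simp [algL1, Finset.mul_sum, abs_mul]

lemma algL1_sub_le {Γ : Type*} [Fintype Γ] (m m' : MonoidAlgebra ℝ Γ) :
    algL1 (m - m') ≤ algL1 m + algL1 m' := by
  unfold algL1
  rw [← Finset.sum_add_distrib]
  refine Finset.sum_le_sum fun x _ => ?_
  rw [MonoidAlgebra.coeff_sub, Finsupp.sub_apply]
  exact abs_sub _ _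

lemma eq_sum_smul_of {Γ : Type*} [Group Γ] [Fintype Γ] (m : MonoidAlgebra ℝ Γ) :
    m = ∑ x, m.coeff x • MonoidAlgebra.of ℝ Γ x := by
  classical
  ext y
  rw [MonoidAlgebra.coeff_sum, Finsupp.finsetSum_apply, Finset.sum_eq_single y]
  · simp
  · intro b _ hb
    simp [hb]
  · simp

lemma algL1_of_mul {Γ : Type*} [Group Γ] [Fintype Γ] (a : Γ) (m : MonoidAlgebra ℝ Γ) :
    algL1 (MonoidAlgebra.of ℝ Γ a * m) = algL1 m := by
  unfold algL1
  rw [← Equiv.sum_comp (Equiv.mulLeft a)]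
  refine Finset.sum_congr rfl fun x _ => ?_
  simp [MonoidAlgebra.of_apply]

lemma algL1_mul_le {Γ : Type*} [Group Γ] [Fintype Γ] (m m' : MonoidAlgebra ℝ Γ) :
    algL1 (m * m') ≤ algL1 m * algL1 m' := by
  nth_rewrite 1 [eq_sum_smul_of m]
  rw [Finset.sum_mul]
  refine (algL1_sum_le _ _).trans_eq ?_
  rw [algL1, Finset.sum_mul]
  refine Finset.sum_congr rfl fun x _ => ?_
  rw [smul_mul_assoc, algL1_smul, algL1_of_mul]

lemma algL1_list_prod_le {Γ : Type*} [Group Γ] [Fintype Γ] (L : List (MonoidAlgebra ℝ Γ))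
    (h : ∀ m ∈ L, algL1 m ≤ 1) : algL1 L.prod ≤ 1 := by
  induction L with
  | nil =>
    rw [List.prod_nil, ← map_one (MonoidAlgebra.of ℝ Γ), algL1_of]
  | cons m L ih =>
    rw [List.prod_cons]
    refine (algL1_mul_le _ _).trans ?_
    exact mul_le_one₀ (h m (by simp)) (Finset.sum_nonneg fun _ _ => abs_nonneg _)
      (ih fun m' hm' => h m' (by simp [hm']))

lemma coeff_mapDomain_eq_sum {Γ Δ : Type*} [Fintype Γ] [DecidableEq Δ] (f : Γ → Δ)
    (m : MonoidAlgebra ℝ Γ) (d : Δ) :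
    (MonoidAlgebra.mapDomain f m).coeff d = ∑ x, if f x = d then m.coeff x else 0 := by
  rw [MonoidAlgebra.mapDomain, MonoidAlgebra.coeff_ofCoeff, Finsupp.mapDomain,
    Finsupp.sum_fintype _ _ (by simp), Finsupp.finsetSum_apply]
  simp [Finsupp.single_apply]

/-! ### Invariance under coordinates -/

variable {n : ℕ+} {G : Type*} [Group G]

/-- The element of `G ≀ S_n` with a single nontrivial coordinate, in the group algebra. -/
def coordAlg (x : Fin n) (g : G) : MonoidAlgebra ℝ (MonomialGroup n G) :=
  MonoidAlgebra.of ℝ _ (SemidirectProduct.inl (Pi.mulSingle x g))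

/-- A permutation, in the group algebra of `G ≀ S_n`. -/
def permAlg (τ : Perm (Fin n)) : MonoidAlgebra ℝ (MonomialGroup n G) :=
  MonoidAlgebra.of ℝ _ (SemidirectProduct.inr τ)

lemma coordAlg_mul (x : Fin n) (g h : G) : coordAlg x g * coordAlg x h = coordAlg x (g * h) := by
  rw [coordAlg, coordAlg, coordAlg, Pi.mulSingle_mul, map_mul, map_mul]

lemma coordAlg_comm {x y : Fin n} (hxy : x ≠ y) (g h : G) :
    coordAlg x g * coordAlg y h = coordAlg y h * coordAlg x g := by
  unfold coordAlg
  have hc := Pi.mulSingle_commute (f := fun _ : Fin n => G) hxy g h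
  rw [← map_mul, ← map_mul, ← map_mul, ← map_mul, hc.eq]

lemma permAlg_mul_coordAlg (τ : Perm (Fin n)) (x : Fin n) (g : G) :
    permAlg τ * coordAlg x g = coordAlg (τ x) g * permAlg τ := by
  unfold coordAlg permAlg
  rw [← map_mul, ← map_mul]
  congr 1
  have h : Pi.mulSingle (τ x) g = permAut n G τ (Pi.mulSingle x g) := by
    funext i
    change _ = (Pi.mulSingle x g : Fin n → G) (τ⁻¹ i)
    by_cases hi : i = τ x
    · subst hi; simp
    · have : τ⁻¹ i ≠ x := fun h => hi (by rw [← h]; simp)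
      rw [Pi.mulSingle_eq_of_ne hi, Pi.mulSingle_eq_of_ne this]
  rw [h, SemidirectProduct.inl_aut, map_inv, inv_mul_cancel_right]

/-- Left invariance of an element of the group algebra under a coordinate. -/
def CoordInv (x : Fin n) (m : MonoidAlgebra ℝ (MonomialGroup n G)) : Prop :=
  ∀ g : G, coordAlg x g * m = m

lemma CoordInv.coordAlg_mul {x y : Fin n} {m : MonoidAlgebra ℝ (MonomialGroup n G)}
    (h : CoordInv x m) (hxy : x ≠ y) (g : G) : CoordInv x (coordAlg y g * m) := fun g' => by
  rw [← mul_assoc, coordAlg_comm hxy, mul_assoc, h]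

lemma CoordInv.permAlg_mul {x : Fin n} {m : MonoidAlgebra ℝ (MonomialGroup n G)}
    (h : CoordInv x m) (τ : Perm (Fin n)) : CoordInv (τ x) (permAlg τ * m) := fun g => by
  rw [← mul_assoc, ← permAlg_mul_coordAlg, mul_assoc, h]

/-- The step of the shuffle at position `l` with group element `g`. -/
def stepElt (l : Fin n) (g : G) : MonomialGroup n G :=
  if l = top n then lastElt n g else warpElt n l g

lemma right_stepElt (l : Fin n) (g : G) : (stepElt l g).right = swap l (top n) := by
  unfold stepElt
  split_ifs with h
  · rw [h, swap_self]; rfl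
  · rfl

variable [Fintype G]

/-- The average over one coordinate, in the group algebra. -/
def coordAvg (x : Fin n) : MonoidAlgebra ℝ (MonomialGroup n G) :=
  (1 / (Fintype.card G : ℝ)) • ∑ g : G, coordAlg x g

lemma coordInv_coordAvg_mul (x : Fin n) (m : MonoidAlgebra ℝ (MonomialGroup n G)) :
    CoordInv x (coordAvg x * m) := fun g => by
  rw [← mul_assoc]
  congr 1
  rw [coordAvg, mul_smul_comm, Finset.mul_sum]
  congr 1
  rw [← Equiv.sum_comp (Equiv.mulLeft g) fun h => coordAlg x h]
  exact Finset.sum_congr rfl fun h _ => coordAlg_mul x g h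

lemma coordAvg_mul_coordAlg (x : Fin n) (g : G) : coordAvg x * coordAlg x g = coordAvg x := by
  rw [coordAvg, smul_mul_assoc, Finset.sum_mul]
  congr 1
  rw [← Equiv.sum_comp (Equiv.mulRight g) fun h => coordAlg x h]
  exact Finset.sum_congr rfl fun h _ => coordAlg_mul x h g

lemma CoordInv.coordAvg_mul {x : Fin n} {m : MonoidAlgebra ℝ (MonomialGroup n G)}
    (h : CoordInv x m) (y : Fin n) : CoordInv x (coordAvg y * m) := by
  by_cases hxy : x = y
  · subst hxy; exact coordInv_coordAvg_mul x m
  · intro g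
    rw [coordAvg, smul_mul_assoc, Finset.sum_mul, mul_smul_comm, Finset.mul_sum]
    congr 1
    exact Finset.sum_congr rfl fun g' _ => h.coordAlg_mul hxy g' g

lemma coordAvg_comm_coordAlg {x y : Fin n} (hxy : x ≠ y) (g : G) :
    coordAvg x * coordAlg y g = coordAlg y g * coordAvg x := by
  rw [coordAvg, smul_mul_assoc, mul_smul_comm, Finset.sum_mul, Finset.mul_sum]
  congr 1
  exact Finset.sum_congr rfl fun h _ => coordAlg_comm hxy h g

lemma coordAvg_comm {x y : Fin n} (hxy : x ≠ y) :
    (coordAvg x * coordAvg y : MonoidAlgebra ℝ (MonomialGroup n G)) = coordAvg y * coordAvg x := by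
  have hy : (coordAvg y : MonoidAlgebra ℝ (MonomialGroup n G))
      = (1 / (Fintype.card G : ℝ)) • ∑ g : G, coordAlg y g := rfl
  rw [hy, smul_mul_assoc, mul_smul_comm, Finset.sum_mul, Finset.mul_sum]
  congr 1
  exact Finset.sum_congr rfl fun h _ => coordAvg_comm_coordAlg hxy h

lemma permAlg_mul_coordAvg (τ : Perm (Fin n)) (x : Fin n) :
    (permAlg τ * coordAvg x : MonoidAlgebra ℝ (MonomialGroup n G))
      = coordAvg (τ x) * permAlg τ := by
  rw [coordAvg, coordAvg, smul_mul_assoc, mul_smul_comm, Finset.sum_mul, Finset.mul_sum]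
  congr 1
  exact Finset.sum_congr rfl fun h _ => permAlg_mul_coordAlg τ x h

/-! ### The steps of the warp-transpose top with random shuffle -/

/-- The random step at position `l`, in the group algebra. -/
def stepAlg (l : Fin n) : MonoidAlgebra ℝ (MonomialGroup n G) :=
  (1 / (Fintype.card G : ℝ)) • ∑ g : G, MonoidAlgebra.of ℝ _ (stepElt l g)

lemma stepAlg_top : (stepAlg (top n) : MonoidAlgebra ℝ (MonomialGroup n G)) = coordAvg (top n) := by
  unfold stepAlg coordAvg
  congr 1
  refine Finset.sum_congr rfl fun g _ => ?_
  rw [stepElt, if_pos rfl]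
  rfl

lemma stepAlg_of_ne {l : Fin n} (hl : l ≠ top n) :
    (stepAlg l : MonoidAlgebra ℝ (MonomialGroup n G)) = (1 / (Fintype.card G : ℝ)) •
      ∑ g : G, coordAlg l g⁻¹ * coordAlg (top n) g * permAlg (swap l (top n)) := by
  unfold stepAlg
  congr 1
  refine Finset.sum_congr rfl fun g _ => ?_
  rw [stepElt, if_neg hl, coordAlg, coordAlg, permAlg, ← map_mul, ← map_mul, ← map_mul]
  congr 1
  exact SemidirectProduct.mk_eq_inl_mul_inr _ _

/-- The average at the top absorbs the factor `g` there, which frees `g⁻¹` at `l` from its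
correlation with `g`; summing over `g` then averages coordinate `l` independently. -/
lemma coordAvg_top_mul_stepAlg {l : Fin n} (hl : l ≠ top n) :
    (coordAvg (top n) * stepAlg l : MonoidAlgebra ℝ (MonomialGroup n G))
      = permAlg (swap l (top n)) * (coordAvg l * coordAvg (top n)) := by
  have h1 : (coordAvg (top n) * stepAlg l : MonoidAlgebra ℝ (MonomialGroup n G))
      = coordAvg l * coordAvg (top n) * permAlg (swap l (top n)) := by
    have h2 : ∀ g : G, coordAvg (top n) *
        (coordAlg l g⁻¹ * coordAlg (top n) g * permAlg (swap l (top n)))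
        = coordAlg l g⁻¹ * (coordAvg (top n) * permAlg (swap l (top n))) := by
      intro g
      rw [← mul_assoc, ← mul_assoc, coordAvg_comm_coordAlg hl.symm, mul_assoc (coordAlg l g⁻¹),
        coordAvg_mul_coordAlg, mul_assoc]
    have h3 : (∑ g : G, coordAlg l g⁻¹ : MonoidAlgebra ℝ (MonomialGroup n G))
        = ∑ g : G, coordAlg l g := Equiv.sum_comp (Equiv.inv G) fun g => coordAlg l g
    rw [stepAlg_of_ne hl, mul_smul_comm, Finset.mul_sum, Finset.sum_congr rfl fun g _ => h2 g,
      ← Finset.sum_mul, h3, mul_assoc, ← smul_mul_assoc]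
    rfl
  rw [h1, ← mul_assoc, permAlg_mul_coordAvg, swap_apply_left, mul_assoc (coordAvg (top n)),
    permAlg_mul_coordAvg, swap_apply_right, ← mul_assoc, coordAvg_comm hl.symm]

/-- The random product of the steps at the positions given by a word. -/
def wordAlg (w : List (Fin n)) : MonoidAlgebra ℝ (MonomialGroup n G) := (w.map stepAlg).prod

/-- An average at the top can be carried through the word, leaving an average at each position it
meets. This treats the letters to the right of an occurrence of `top n`; `coordInv_wordAlg` treats
those to its left. -/
lemma coordInv_coordAvg_mul_wordAlg (w : List (Fin n)) {x : Fin n} (hx : x = top n ∨ x ∈ w) :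
    CoordInv x (coordAvg (top n) * wordAlg w : MonoidAlgebra ℝ (MonomialGroup n G)) := by
  induction w generalizing x with
  | nil =>
    rcases hx with rfl | hx
    · exact coordInv_coordAvg_mul _ _
    · simp at hx
  | cons l w ih =>
    have hcons : (wordAlg (l :: w) : MonoidAlgebra ℝ (MonomialGroup n G))
        = stepAlg l * wordAlg w := by simp [wordAlg]
    rw [hcons]
    by_cases hl : l = top n
    · subst hl
      rw [stepAlg_top]
      rcases hx with rfl | hx
      · exact coordInv_coordAvg_mul _ _
      · rcases List.mem_cons.1 hx with rfl | hx
        · exact coordInv_coordAvg_mul _ _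
        · exact (ih (.inr hx)).coordAvg_mul _
    · rw [← mul_assoc, coordAvg_top_mul_stepAlg hl, mul_assoc, mul_assoc]
      by_cases hxt : x = top n
      · subst hxt
        have := (coordInv_coordAvg_mul l (coordAvg (top n) * wordAlg w :
          MonoidAlgebra ℝ (MonomialGroup n G))).permAlg_mul (swap l (top n))
        rwa [swap_apply_left] at this
      · by_cases hxl : x = l
        · subst hxl
          have := ((ih (.inl rfl)).coordAvg_mul x).permAlg_mul (swap x (top n))
          rwa [swap_apply_right] at this
        · have hxw : x ∈ w := by
            rcases hx with h | h
            · exact absurd h hxt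
            · exact (List.mem_cons.1 h).resolve_left hxl
          have := ((ih (.inr hxw)).coordAvg_mul l).permAlg_mul (swap l (top n))
          rwa [swap_apply_of_ne_of_ne hxl hxt] at this

/-- A random product in which the top position occurs is invariant under every coordinate that
occurs in its word. -/
lemma coordInv_wordAlg {w : List (Fin n)} (ht : top n ∈ w) {x : Fin n} (hx : x ∈ w) :
    CoordInv x (wordAlg w : MonoidAlgebra ℝ (MonomialGroup n G)) := by
  induction w generalizing x with
  | nil => simp at hx
  | cons l w ih =>
    have hcons : (wordAlg (l :: w) : MonoidAlgebra ℝ (MonomialGroup n G))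
        = stepAlg l * wordAlg w := by simp [wordAlg]
    rw [hcons]
    by_cases hl : l = top n
    · subst hl
      rw [stepAlg_top]
      exact coordInv_coordAvg_mul_wordAlg w (List.mem_cons.1 hx)
    · have htw : top n ∈ w := (List.mem_cons.1 ht).resolve_left fun h => hl h.symm
      have hinv := ih htw htw
      have hlinv : CoordInv l (permAlg (swap l (top n)) * wordAlg w :
          MonoidAlgebra ℝ (MonomialGroup n G)) := by
        have := hinv.permAlg_mul (swap l (top n))
        rwa [swap_apply_right] at this
      -- The swap carries the top invariance of the tail to `l`, where it absorbs `g⁻¹`. The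
      -- remaining `g` is an independent average at the top.
      have heq : (stepAlg l * wordAlg w : MonoidAlgebra ℝ (MonomialGroup n G))
          = coordAvg (top n) * (permAlg (swap l (top n)) * wordAlg w) := by
        rw [stepAlg_of_ne hl, coordAvg, smul_mul_assoc, smul_mul_assoc, Finset.sum_mul,
          Finset.sum_mul]
        congr 1
        refine Finset.sum_congr rfl fun g _ => ?_
        rw [coordAlg_comm hl, mul_assoc, mul_assoc, hlinv]
      rw [heq]
      by_cases hxt : x = top n
      · subst hxt; exact coordInv_coordAvg_mul _ _
      · by_cases hxl : x = l
        · subst hxl; exact hlinv.coordAvg_mul _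
        · have hxw : x ∈ w := (List.mem_cons.1 hx).resolve_left hxl
          have := (ih htw hxw).permAlg_mul (swap l (top n))
          rw [swap_apply_of_ne_of_ne hxl hxt] at this
          exact this.coordAvg_mul _

end WarpShuffle

end

/-! ### Uniformity along the fibres and comparison of the two shuffles -/

noncomputable section

namespace WarpShuffle

open Equiv

variable {n : ℕ+} {G : Type*} [Group G]

/-- The single coordinates generate `G ^ n`: induct on a set containing the support of `h`. -/
lemma of_inl_mul_of_coordInv {m : MonoidAlgebra ℝ (MonomialGroup n G)}
    (hm : ∀ x, CoordInv x m) (h : Fin n → G) :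
    MonoidAlgebra.of ℝ (MonomialGroup n G) (SemidirectProduct.inl h) * m = m := by
  have key : ∀ s : Finset (Fin n), ∀ h : Fin n → G, (∀ x ∉ s, h x = 1) →
      MonoidAlgebra.of ℝ (MonomialGroup n G) (SemidirectProduct.inl h) * m = m := by
    intro s
    induction s using Finset.induction_on with
    | empty =>
      intro h hh
      have : h = 1 := funext fun x => hh x (by simp)
      rw [this, map_one, map_one, one_mul]
    | insert a s ha ih =>
      intro h hh
      have hdec : h = Pi.mulSingle a (h a) * Function.update h a 1 := by
        funext x
        by_cases hx : x = a
        · subst hx; simp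
        · simp [hx]
      have h2 := ih (Function.update h a 1) fun x hx => by
        by_cases hxa : x = a
        · subst hxa; simp
        · rw [Function.update_of_ne hxa]
          exact hh x (by simp [hxa, hx])
      rw [hdec, map_mul, map_mul, mul_assoc, h2]
      exact hm a (h a)
  exact key Finset.univ h (by simp)

variable [Fintype G]

lemma sum_monomialGroup (F : MonomialGroup n G → ℝ) :
    ∑ y, F y = ∑ h : Fin n → G, ∑ π : Perm (Fin n), F ⟨h, π⟩ := by
  rw [← Fintype.sum_prod_type' (fun (h : Fin n → G) (π : Perm (Fin n)) => F ⟨h, π⟩)]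
  exact Fintype.sum_equiv SemidirectProduct.equivProd _ _ fun y => rfl

lemma card_monomialGroup : (Fintype.card (MonomialGroup n G) : ℝ)
    = (Fintype.card G : ℝ) ^ (n : ℕ) * Fintype.card (Perm (Fin n)) := by
  have h : Fintype.card (MonomialGroup n G) = Fintype.card ((Fin n → G) × Perm (Fin n)) :=
    Fintype.card_congr SemidirectProduct.equivProd
  rw [h, Fintype.card_prod, Fintype.card_fun, Fintype.card_fin]
  push_cast
  rfl

variable (G) in
/-- The lift of a function on `S_n` to `G ≀ S_n`, uniform along the fibres. -/
def fibreLift (f : Perm (Fin n) → ℝ) (y : MonomialGroup n G) : ℝ :=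
  ((Fintype.card G : ℝ) ^ (n : ℕ))⁻¹ * f y.right

lemma sum_abs_fibreLift (f : Perm (Fin n) → ℝ) :
    ∑ y, |fibreLift G f y| = ∑ π, |f π| := by
  have hG : (0 : ℝ) < (Fintype.card G : ℝ) ^ (n : ℕ) := by
    have : (0 : ℝ) < Fintype.card G := by exact_mod_cast Fintype.card_pos
    positivity
  rw [sum_monomialGroup]
  simp only [fibreLift, abs_mul, abs_inv, abs_of_pos hG, ← Finset.mul_sum]
  rw [Finset.sum_const, Finset.card_univ, Fintype.card_fun, Fintype.card_fin, nsmul_eq_mul]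
  push_cast
  rw [← mul_assoc, inv_mul_cancel₀ hG.ne', one_mul]

/-- Left translation by `G ^ n` is transitive on each fibre over `S_n`, so an invariant element is
constant there and is recovered from its push-forward. -/
lemma eq_toAlg_fibreLift {m : MonoidAlgebra ℝ (MonomialGroup n G)}
    (hm : ∀ x, CoordInv x m) :
    m = toAlg (fibreLift G
      (MonoidAlgebra.mapDomain (SemidirectProduct.rightHom (φ := permAut n G)) m).coeff) := by
  classical
  have hG : (0 : ℝ) < (Fintype.card G : ℝ) ^ (n : ℕ) := by
    have : (0 : ℝ) < Fintype.card G := by exact_mod_cast Fintype.card_pos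
    positivity
  have hconst : ∀ (h : Fin n → G) (π : Perm (Fin n)),
      m.coeff ⟨h, π⟩ = m.coeff (SemidirectProduct.inr π) := by
    intro h π
    have h1 := congrArg (fun z => z.coeff (⟨h, π⟩ : MonomialGroup n G))
      (of_inl_mul_of_coordInv hm h)
    simp only [MonoidAlgebra.of_apply] at h1
    rw [← h1, SemidirectProduct.mk_eq_inl_mul_inr, MonoidAlgebra.coeff_single_mul_mul, one_mul]
  ext y
  obtain ⟨h, π⟩ := y
  rw [coeff_toAlg, fibreLift, coeff_mapDomain_eq_sum, sum_monomialGroup, hconst]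
  have : ∀ h : Fin n → G, ∑ ρ : Perm (Fin n),
      (if (SemidirectProduct.rightHom (⟨h, ρ⟩ : MonomialGroup n G)) = π
        then m.coeff ⟨h, ρ⟩ else 0) = m.coeff (SemidirectProduct.inr π) := by
    intro h
    rw [Finset.sum_eq_single π]
    · exact (if_pos rfl).trans (hconst h π)
    · exact fun ρ _ hρ => if_neg hρ
    · simp
  rw [Finset.sum_congr rfl fun h _ => this h, Finset.sum_const, Finset.card_univ,
    Fintype.card_fun, Fintype.card_fin, nsmul_eq_mul]
  push_cast
  rw [← mul_assoc, inv_mul_cancel₀ hG.ne', one_mul]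

lemma algL1_stepAlg_le (l : Fin n) :
    algL1 (stepAlg l : MonoidAlgebra ℝ (MonomialGroup n G)) ≤ 1 := by
  have hG : (0 : ℝ) < Fintype.card G := by exact_mod_cast Fintype.card_pos
  rw [stepAlg, algL1_smul, abs_of_pos (by positivity), one_div, inv_mul_le_iff₀ hG, mul_one]
  refine (algL1_sum_le _ _).trans_eq ?_
  simp [algL1_of, -MonoidAlgebra.of_apply]

lemma mapDomain_wordAlg (w : List (Fin n)) :
    MonoidAlgebra.mapDomain (SemidirectProduct.rightHom (φ := permAut n G)) (wordAlg w)
      = MonoidAlgebra.of ℝ _ (w.map fun l => swap l (top n)).prod := by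
  have hstep : ∀ l : Fin n, MonoidAlgebra.mapDomainRingHom ℝ
      (SemidirectProduct.rightHom (φ := permAut n G)) (stepAlg l)
      = MonoidAlgebra.of ℝ _ (swap l (top n)) := by
    intro l
    have hG : (Fintype.card G : ℝ) ≠ 0 := by exact_mod_cast Fintype.card_ne_zero
    have h1 : ∀ g : G, MonoidAlgebra.mapDomainRingHom ℝ
        (SemidirectProduct.rightHom (φ := permAut n G))
        ((1 / (Fintype.card G : ℝ)) • MonoidAlgebra.of ℝ _ (stepElt l g))
        = (1 / (Fintype.card G : ℝ)) • MonoidAlgebra.of ℝ _ (swap l (top n)) := by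
      intro g
      rw [MonoidAlgebra.of_apply, MonoidAlgebra.of_apply, MonoidAlgebra.smul_single,
        MonoidAlgebra.smul_single, MonoidAlgebra.mapDomainRingHom_apply,
        MonoidAlgebra.mapDomain_single, SemidirectProduct.rightHom_eq_right, right_stepElt]
    rw [stepAlg, Finset.smul_sum, map_sum, Finset.sum_congr rfl fun g _ => h1 g,
      Finset.sum_const, Finset.card_univ, ← Nat.cast_smul_eq_nsmul ℝ, smul_smul,
      mul_one_div_cancel hG, one_smul]
  change MonoidAlgebra.mapDomainRingHom ℝ (SemidirectProduct.rightHom (φ := permAut n G))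
    (wordAlg w) = _
  rw [wordAlg, map_list_prod, map_list_prod, List.map_map, List.map_map]
  congr 1
  exact List.map_congr_left fun l _ => hstep l

/-- If every position occurs in the word, the random product is uniform along the fibre over its
permutation. -/
lemma wordAlg_eq_of_forall_mem {w : List (Fin n)} (hw : ∀ x, x ∈ w) :
    wordAlg w = toAlg (fibreLift G
      (MonoidAlgebra.of ℝ _ (w.map fun l => swap l (top n)).prod).coeff) := by
  rw [← mapDomain_wordAlg (G := G)]
  exact eq_toAlg_fibreLift fun x => coordInv_wordAlg (hw _) (hw x)

lemma algL1_toAlg_fibreLift (f : Perm (Fin n) → ℝ) :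
    algL1 (toAlg (fibreLift G f)) = ∑ π, |f π| := sum_abs_fibreLift f

lemma algL1_wordAlg_sub_le (w : List (Fin n)) :
    algL1 (wordAlg w - toAlg (fibreLift G
      (MonoidAlgebra.of ℝ _ (w.map fun l => swap l (top n)).prod).coeff)) ≤ 2 := by
  refine (algL1_sub_le _ _).trans ?_
  rw [algL1_toAlg_fibreLift]
  have h1 : algL1 (wordAlg w : MonoidAlgebra ℝ (MonomialGroup n G)) ≤ 1 := by
    refine algL1_list_prod_le _ fun m hm => ?_
    obtain ⟨l, _, rfl⟩ := List.mem_map.1 hm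
    exact algL1_stepAlg_le l
  have h2 := algL1_of (w.map fun l => swap l (top n)).prod
  rw [algL1] at h2
  rw [h2]
  linarith

lemma toAlg_warpMeasure : toAlg (warpMeasure n G) = (1 / (n : ℝ)) • ∑ l : Fin n, stepAlg l := by
  classical
  have hinj : ∀ (l l' : Fin n) (g g' : G), stepElt l g = stepElt l' g' → l = l' ∧ g = g' := by
    intro l l' g g' h
    have hl : l = l' := by
      have := congrArg (fun y : MonomialGroup n G => y.right (top n)) h
      simpa [right_stepElt] using this
    subst hl
    refine ⟨rfl, ?_⟩
    by_cases hl : l = top n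
    · have := congrArg (fun y : MonomialGroup n G => y.left (top n)) h
      simpa [stepElt, hl, lastElt] using this
    · have := congrArg (fun y : MonomialGroup n G => y.left (top n)) h
      have hl' : top n ≠ l := fun h => hl h.symm
      simpa [stepElt, hl, warpElt, hl'] using this
  ext y
  have hco : ((1 / (n : ℝ)) • ∑ l : Fin n, (stepAlg l : MonoidAlgebra ℝ (MonomialGroup n G))).coeff y
      = (1 / ((n : ℝ) * Fintype.card G)) *
        ∑ l : Fin n, ∑ g : G, if stepElt l g = y then (1 : ℝ) else 0 := by
    simp only [stepAlg, MonoidAlgebra.coeff_smul, MonoidAlgebra.coeff_sum, Finsupp.smul_apply,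
      Finsupp.finsetSum_apply, MonoidAlgebra.of_apply, MonoidAlgebra.coeff_single,
      Finsupp.single_apply, smul_eq_mul, ← Finset.mul_sum]
    rw [← mul_assoc, one_div_mul_one_div]
  rw [hco, coeff_toAlg, warpMeasure]
  by_cases h : ∃ l g, stepElt l g = y
  · obtain ⟨l, g, hlg⟩ := h
    rw [Finset.sum_eq_single l, Finset.sum_eq_single g, if_pos hlg, mul_one, if_pos]
    · by_cases hl : l = top n
      · left; exact ⟨g, by rw [← hlg, stepElt, if_pos hl]⟩
      · right; exact ⟨g, l, hl, by rw [← hlg, stepElt, if_neg hl]⟩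
    · exact fun g' _ hne => if_neg fun h' => hne (hinj _ _ _ _ (h'.trans hlg.symm)).2
    · simp
    · exact fun l' _ hne => Finset.sum_eq_zero fun g' _ => if_neg fun h' =>
        hne (hinj _ _ _ _ (h'.trans hlg.symm)).1
    · simp
  · rw [if_neg, Finset.sum_eq_zero, mul_zero]
    · exact fun l _ => Finset.sum_eq_zero fun g _ => if_neg fun h' => h ⟨l, g, h'⟩
    · rintro (⟨g, rfl⟩ | ⟨g, l, hl, rfl⟩)
      · exact h ⟨top n, g, by rw [stepElt, if_pos rfl]⟩
      · exact h ⟨l, g, by rw [stepElt, if_neg hl]⟩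

lemma toAlg_convPow_warpMeasure (k : ℕ) :
    toAlg (convPow (warpMeasure n G) k)
      = (1 / (n : ℝ)) ^ k • ∑ w : Fin k → Fin n, wordAlg (List.ofFn w) := by
  rw [toAlg_convPow, toAlg_warpMeasure, smul_pow, sum_pow_eq_sum_words]
  congr 1
  refine Finset.sum_congr rfl fun w _ => ?_
  rw [wordAlg, List.map_ofFn]
  rfl

lemma toAlg_convPow_transposeTopMeasure (k : ℕ) :
    toAlg (convPow (transposeTopMeasure n) k) = (1 / (n : ℝ)) ^ k •
      ∑ w : Fin k → Fin n, MonoidAlgebra.of ℝ _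
        ((List.ofFn w).map fun l => swap l (top n)).prod := by
  have h1 : toAlg (transposeTopMeasure n)
      = (1 / (n : ℝ)) • ∑ l : Fin n, MonoidAlgebra.of ℝ _ (swap l (top n)) := by
    ext π
    rw [coeff_toAlg, transposeTopMeasure_eq_sum]
    simp [Finsupp.single_apply]
  rw [toAlg_convPow, h1, smul_pow, sum_pow_eq_sum_words]
  congr 1
  refine Finset.sum_congr rfl fun w _ => ?_
  rw [map_list_prod, List.map_map, List.map_ofFn]
  rfl

/-- Coupon collector: a union bound over the missed position. -/
lemma card_not_surjective_le (k : ℕ) :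
    ((Finset.univ.filter fun w : Fin k → Fin n => ¬ ∀ x, x ∈ List.ofFn w).card : ℝ)
      ≤ n * ((n : ℝ) - 1) ^ k := by
  have hsub : (Finset.univ.filter fun w : Fin k → Fin n => ¬ ∀ x, x ∈ List.ofFn w)
      ⊆ Finset.univ.biUnion fun x : Fin n =>
        Fintype.piFinset fun _ : Fin k => Finset.univ.erase x := by
    intro w hw
    simp only [Finset.mem_filter, not_forall, List.mem_ofFn] at hw
    obtain ⟨-, x, hx⟩ := hw
    simp only [Finset.mem_biUnion, Fintype.mem_piFinset, Finset.mem_erase]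
    exact ⟨x, Finset.mem_univ x, fun i => ⟨fun h => hx ⟨i, h⟩, Finset.mem_univ _⟩⟩
  have hcard := (Finset.card_le_card hsub).trans Finset.card_biUnion_le
  simp only [Fintype.card_piFinset, Finset.card_erase_of_mem (Finset.mem_univ _),
    Finset.card_univ, Fintype.card_fin, Finset.prod_const, Finset.sum_const, smul_eq_mul] at hcard
  have h1 : (1 : ℕ) ≤ n := n.pos
  have h2 : (((n : ℕ) - 1 : ℕ) : ℝ) = (n : ℝ) - 1 := by push_cast [Nat.cast_sub h1]; ring
  rw [← h2]
  exact_mod_cast hcard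

/-- The warp-transpose top with random shuffle is close to the fibrewise uniform lift of the
transpose top with random shuffle, up to the coupon collector's probability. -/
lemma algL1_warp_sub_lift_le (k : ℕ) :
    algL1 (toAlg (convPow (warpMeasure n G) k)
        - toAlg (fibreLift G (convPow (transposeTopMeasure n) k)))
      ≤ 2 * (n * ((1 - 1 / (n : ℝ)) ^ k)) := by
  classical
  have hn : (0 : ℝ) < n := by exact_mod_cast n.pos
  let D : (Fin k → Fin n) → MonoidAlgebra ℝ (MonomialGroup n G) := fun w =>
    wordAlg (List.ofFn w) - toAlg (fibreLift G
      (MonoidAlgebra.of ℝ _ ((List.ofFn w).map fun l => swap l (top n)).prod).coeff)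
  have hlift : toAlg (fibreLift G (convPow (transposeTopMeasure n) k))
      = (1 / (n : ℝ)) ^ k • ∑ w : Fin k → Fin n, toAlg (fibreLift G
        (MonoidAlgebra.of ℝ _ ((List.ofFn w).map fun l => swap l (top n)).prod).coeff) := by
    ext y
    have h := congrArg (fun m => m.coeff y.right)
      (toAlg_convPow_transposeTopMeasure (n := n) k)
    simp only [MonoidAlgebra.coeff_smul, MonoidAlgebra.coeff_sum, Finsupp.smul_apply,
      Finsupp.finsetSum_apply, coeff_toAlg, smul_eq_mul, fibreLift] at h ⊢
    rw [h, ← Finset.mul_sum]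
    ring
  have hdiff : toAlg (convPow (warpMeasure n G) k)
      - toAlg (fibreLift G (convPow (transposeTopMeasure n) k)) = (1 / (n : ℝ)) ^ k • ∑ w, D w := by
    rw [toAlg_convPow_warpMeasure, hlift, ← smul_sub, ← Finset.sum_sub_distrib]
  have hD : ∀ w, algL1 (D w) ≤ if ¬ ∀ x, x ∈ List.ofFn w then 2 else 0 := by
    intro w
    split_ifs with h
    · have : D w = 0 := sub_eq_zero.2 (wordAlg_eq_of_forall_mem h)
      simp [this, algL1]
    · exact algL1_wordAlg_sub_le _
  have hsum : algL1 (∑ w, D w) ≤ 2 * (n * ((n : ℝ) - 1) ^ k) := by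
    refine (algL1_sum_le _ _).trans ((Finset.sum_le_sum fun w _ => hD w).trans ?_)
    rw [← Finset.sum_filter, Finset.sum_const, nsmul_eq_mul, mul_comm]
    have := card_not_surjective_le (n := n) k
    linarith
  rw [hdiff, algL1_smul, abs_of_nonneg (by positivity)]
  calc (1 / (n : ℝ)) ^ k * algL1 (∑ w, D w)
      ≤ (1 / (n : ℝ)) ^ k * (2 * (n * ((n : ℝ) - 1) ^ k)) := by gcongr
    _ = 2 * (n * ((1 / (n : ℝ)) ^ k * ((n : ℝ) - 1) ^ k)) := by ring
    _ = _ := by rw [← mul_pow]; congr 4; field_simp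

lemma toAlg_sub {Γ : Type*} [Fintype Γ] (p q : Γ → ℝ) :
    toAlg (fun x => p x - q x) = toAlg p - toAlg q := by
  ext x; rfl

/-- Mixing of the warp-transpose top with random shuffle. -/
theorem tvDist_warp_le {C : ℝ} (hC : 1 < C) {k : ℕ}
    (hk : (n : ℝ) * Real.log n + C * n ≤ k) :
    tvDist (convPow (warpMeasure n G) k) (uniform (MonomialGroup n G)) ≤ 4 * Real.exp (-C) := by
  have hn : (0 : ℝ) < n := by exact_mod_cast n.pos
  refine (tvDist_le_sum_abs _ _).trans ?_
  have hlift : ∑ y : MonomialGroup n G, |fibreLift G (convPow (transposeTopMeasure n) k) y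
      - uniform (MonomialGroup n G) y| ≤ 2 * Real.exp (-C) := by
    have h1 : ∀ y : MonomialGroup n G, fibreLift G (convPow (transposeTopMeasure n) k) y
        - uniform (MonomialGroup n G) y = fibreLift G
          (fun π => convPow (transposeTopMeasure n) k π - uniform (Perm (Fin n)) π) y := by
      intro y
      simp only [fibreLift, uniform, card_monomialGroup]
      rw [mul_sub, one_div, one_div, mul_inv]
    rw [Finset.sum_congr rfl fun y _ => by rw [h1 y], sum_abs_fibreLift]
    exact sum_abs_transposeTop_sub_uniform_le n hC hk
  have hcoll : (n : ℝ) * (1 - 1 / (n : ℝ)) ^ k ≤ Real.exp (-C) := by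
    have h0 : (0 : ℝ) ≤ 1 - 1 / n := by
      have : (1 : ℝ) ≤ n := by exact_mod_cast one_le (a := n)
      rw [sub_nonneg, div_le_one hn]; exact this
    have h1 : (1 - 1 / (n : ℝ)) ^ k ≤ Real.exp (-(k / n)) := by
      have h2 : 1 - 1 / (n : ℝ) ≤ Real.exp (-(1 / n)) := by
        have := Real.add_one_le_exp (-(1 / (n : ℝ))); linarith
      calc (1 - 1 / (n : ℝ)) ^ k ≤ Real.exp (-(1 / n)) ^ k := pow_le_pow_left₀ h0 h2 k
        _ = _ := by rw [← Real.exp_nat_mul]; congr 1; ring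
    have h3 : Real.exp (-(k / n)) ≤ Real.exp (-Real.log n + -C) := by
      apply Real.exp_le_exp.2
      have : Real.log n + C ≤ k / n := by
        rw [le_div_iff₀ hn]; linarith
      linarith
    rw [Real.exp_add, Real.exp_neg (Real.log n), Real.exp_log hn] at h3
    calc (n : ℝ) * (1 - 1 / (n : ℝ)) ^ k ≤ n * ((n : ℝ)⁻¹ * Real.exp (-C)) := by
          gcongr; exact h1.trans h3
      _ = _ := by field_simp
  have hd : ∑ y : MonomialGroup n G, |convPow (warpMeasure n G) k y
      - fibreLift G (convPow (transposeTopMeasure n) k) y| ≤ 2 * Real.exp (-C) := by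
    have h := algL1_warp_sub_lift_le (n := n) (G := G) k
    have h2 : ∑ y : MonomialGroup n G, |convPow (warpMeasure n G) k y
        - fibreLift G (convPow (transposeTopMeasure n) k) y|
        = algL1 (toAlg (convPow (warpMeasure n G) k)
        - toAlg (fibreLift G (convPow (transposeTopMeasure n) k))) := by
      rw [← toAlg_sub]; rfl
    rw [h2]
    linarith
  calc ∑ y, |convPow (warpMeasure n G) k y - uniform (MonomialGroup n G) y|
      ≤ ∑ y, (|convPow (warpMeasure n G) k y - fibreLift G (convPow (transposeTopMeasure n) k) y|
        + |fibreLift G (convPow (transposeTopMeasure n) k) y - uniform (MonomialGroup n G) y|) :=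
        Finset.sum_le_sum fun y _ => abs_sub_le _ _ _
    _ ≤ 4 * Real.exp (-C) := by
        rw [Finset.sum_add_distrib]; linarith

end WarpShuffle

end

open WarpShuffle in
theorem mainTheorem6 :
    ∃ a : ℝ,
      -- `a` is a universal constant in the bound for the transpose top with random shuffle
      (∀ (n : ℕ+) (C : ℝ), 1 < C →
        tvDist (convPow (transposeTopMeasure n) ⌈(n : ℝ) * Real.log n + C * n⌉₊)
          (uniform (Equiv.Perm (Fin n))) ≤ a * Real.exp (-C)) ∧
      ∀ (G : ℕ+ → Type*) [∀ n, Group (G n)] [∀ n, Fintype (G n)] [∀ n, Nontrivial (G n)],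
        (∀ (n : ℕ+) (C : ℝ) (k : ℕ), 1 < C → (n : ℝ) * Real.log n + C * n ≤ k →
          tvDist (convPow (warpMeasure n (G n)) k) (uniform (MonomialGroup n (G n))) <
            a * Real.exp (-C) + (Real.exp 1 + 1) * Real.exp (-C / 2)) ∧
        ∀ ε : ℝ, 0 < ε → ε < 1 →
          Filter.Tendsto
            (fun n : ℕ+ =>
              tvDist (convPow (warpMeasure n (G n)) ⌊(1 + ε) * ((n : ℝ) * Real.log n)⌋₊)
                (uniform (MonomialGroup n (G n))))
            Filter.atTop (nhds 0) := by
  -- `4 = 2 + 2`: mixing on `S_n` plus the coupon-collector error. The term with `exp (-C / 2)` is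
  -- needed only for strictness.
  refine ⟨4, fun n C hC => ?_, fun G _ _ _ => ⟨fun n C k hC hk => ?_, fun ε hε _ => ?_⟩⟩
  · refine (tvDist_le_sum_abs _ _).trans ?_
    have := sum_abs_transposeTop_sub_uniform_le n hC (Nat.le_ceil _)
    have := Real.exp_pos (-C)
    linarith
  · refine (tvDist_warp_le hC hk).trans_lt ?_
    have := Real.exp_pos (-C / 2)
    have := Real.exp_pos 1
    have : 0 < (Real.exp 1 + 1) * Real.exp (-C / 2) := by positivity
    linarith
  · have hlog : Filter.Tendsto (fun n : ℕ+ => ε * Real.log (n : ℝ) - 1) Filter.atTop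
        Filter.atTop := by
      refine Filter.tendsto_atTop_add_const_right _ _ (Filter.Tendsto.const_mul_atTop hε ?_)
      exact Real.tendsto_log_atTop.comp
        (tendsto_natCast_atTop_atTop.comp tendsto_PNat_val_atTop_atTop)
    have hbound : Filter.Tendsto (fun n : ℕ+ => 4 * Real.exp (-(ε * Real.log (n : ℝ) - 1)))
        Filter.atTop (nhds 0) := by
      have := (Real.tendsto_exp_neg_atTop_nhds_zero.comp hlog).const_mul 4
      simpa using this
    refine squeeze_zero' (Filter.Eventually.of_forall fun n => tvDist_nonneg _ _) ?_ hbound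
    -- Apply the bound with `C = ε * log n - 1`; the `-1` leaves room of `n ≥ 1` steps, which covers
    -- the loss from the floor.
    filter_upwards [hlog.eventually_gt_atTop 1] with n hn
    refine tvDist_warp_le hn ?_
    have h1 := Nat.sub_one_lt_floor ((1 + ε) * ((n : ℝ) * Real.log n))
    have h2 : (1 : ℝ) ≤ n := by exact_mod_cast one_le (a := n)
    nlinarith
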